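/- Let $d\ge 0$ and $p\ge 1$ be integers, let $z_1,\dots,z_p\in\mathbb R^d$ and $\eta\in(0,1)$ be fixed, and let $$V(x,\theta) := -\log\Big(\sum_{i=1}^p H(\theta_i)\,\exp(-\|x-z_i\|^2)\Big),\qquad x\in\mathbb R^d,\ \theta\in\mathbb R^p,$$ where $\|\cdot\|$ is the Euclidean norm and $H(t):=\eta+(1-\eta)\,\dfrac{1}{1+e^{-t}}$. Then the following hold. 1. (Uniform log-Sobolev inequality.) For every $\theta$, the Gibbs measure $\pi^\star(\theta)$ with Lebesgue density $e^{-V(x,\theta)}/Z_\theta$, $Z_\theta=\int_{\mathbb R^d} e^{-V(x,\theta)}\,dx$, is a well-defined probability measure, and there is a constant $\mu>0$, not depending on $\theta$, such that for all $\theta\in\mathbb R^p$ and all probability measures $P$ on $\mathbb R^d$, $$\mathrm{KL}\big(P\,\|\,\pi^\star(\theta)\big)\le \frac1{2\mu}\,\Big\|\nabla\log\frac{P}{\pi^\star(\theta)}\Big\|_{L^2(P)}^2 .$$ Here, if $P\ll\pi^\star(\theta)$ and the density $f=dP/d\pi^\star(\theta)$ has a locally integrable weak gradient $\nabla f$, then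 $\nabla\log\frac{P}{\pi^\star(\theta)}$ means $\nabla f/f$ (defined $P$-almost everywhere); otherwise the right-hand side is $+\infty$. 2. (Bounded parameter gradient.) $V$ is continuously differentiable on $\mathbb R^d\times\mathbb R^p$, and there is a constant $C$ with $\|\nabla_\theta V(x,\theta)\|\le C$ for all $x\in\mathbb R^d$, $\theta\in\mathbb R^p$. More precisely, $\|\nabla_\theta V(x,\theta)\|_1=\sum_{i=1}^p|\partial_{\theta_i}V(x,\theta)|\le 1/\eta$ for all $x,\theta$. -/

import Mathlib

open MeasureTheory InformationTheory
open scoped ENNReal ContDiff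

noncomputable section

/-- `ℝᵈ` with its Euclidean norm. -/
abbrev Eucl (d : ℕ) : Type := EuclideanSpace ℝ (Fin d)

/-- `g` is the weak (distributional) gradient of `f` on `ℝᵈ`: both are locally integrable and
`∫ f ∇φ = - ∫ φ g` for every smooth compactly supported test function `φ`. -/
def HasWeakGradient {d : ℕ} (f : Eucl d → ℝ) (g : Eucl d → Eucl d) : Prop :=
  LocallyIntegrable f volume ∧ LocallyIntegrable g volume ∧
    ∀ φ : Eucl d → ℝ, ContDiff ℝ ∞ φ → HasCompactSupport φ →
      ∫ x, f x • gradient φ x = - ∫ x, φ x • g x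

/-- The squared norm `‖∇ log (P / Q)‖²` in `L²(P)` (relative Fisher information), with values in
`[0, ∞]`, for `Q` having the same null sets as Lebesgue measure. If `P ≪ Q` and the density
`f = dP/dQ` has a weak gradient `g`, then `∇ log f = f⁻¹ g` holds `P`-almost everywhere and the
value is `∫ ‖f⁻¹ g‖² dP`. In every other case the value is `∞`. A weak gradient is unique up to a
null set, so the infimum is over at most one value (it is `∞` over the empty family). -/
def relFisherInfo {d : ℕ} (P Q : Measure (Eucl d)) : ℝ≥0∞ :=
  ⨅ (g : Eucl d → Eucl d)
    (_ : P ≪ Q ∧ HasWeakGradient (fun x => (P.rnDeriv Q x).toReal) g),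
    ∫⁻ x, ‖((P.rnDeriv Q x).toReal)⁻¹ • g x‖ₑ ^ 2 ∂P

/-- The log-Sobolev inequality with constant `μ` for a measure `Q` on `ℝᵈ`:
`KL(P ‖ Q) ≤ (1 / (2μ)) ‖∇ log (P / Q)‖²` in `L²(P)`, for all probability measures `P`. -/
def LogSobolev {d : ℕ} (μ : ℝ) (Q : Measure (Eucl d)) : Prop :=
  ∀ P : Measure (Eucl d), IsProbabilityMeasure P →
    klDiv P Q ≤ ENNReal.ofReal (1 / (2 * μ)) * relFisherInfo P Q

/-- The Gibbs distribution of density `exp (-V x θ) / Z_θ`, `Z_θ = ∫ exp (-V x θ) dx`. -/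
def gibbs {d p : ℕ} (V : Eucl d → Eucl p → ℝ) (θ : Eucl p) : Measure (Eucl d) :=
  (volume : Measure (Eucl d)).tilted (fun x => - V x θ)

/-- The Gibbs measures of `V` are well-defined probability measures and satisfy a log-Sobolev
inequality with one constant `μ > 0` for all parameters `θ`. -/
def UniformLogSobolev {d p : ℕ} (V : Eucl d → Eucl p → ℝ) : Prop :=
  ∃ μ : ℝ, 0 < μ ∧ ∀ θ : Eucl p, IsProbabilityMeasure (gibbs V θ) ∧ LogSobolev μ (gibbs V θ)

/-- `V` is (jointly) continuously differentiable and its gradient in the parameter is bounded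
by `C` in Euclidean norm. -/
def BoundedParamGradient {d p : ℕ} (V : Eucl d → Eucl p → ℝ) (C : ℝ) : Prop :=
  ContDiff ℝ 1 (fun q : Eucl d × Eucl p => V q.1 q.2) ∧
    ∀ (θ : Eucl p) (x : Eucl d), ‖gradient (V x) θ‖ ≤ C

/-- The shifted logistic function `η + (1 - η) / (1 + exp (-t))`. -/
def shiftedLogistic (η t : ℝ) : ℝ := η + (1 - η) * (1 / (1 + Real.exp (-t)))

/-- The potential `V(x, θ) = - log ∑ᵢ H(θᵢ) exp (-‖x - zᵢ‖²)`. -/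
def mixturePotential {d p : ℕ} (η : ℝ) (z : Fin p → Eucl d) (x : Eucl d) (θ : Eucl p) : ℝ :=
  - Real.log (∑ i, shiftedLogistic η (θ i) * Real.exp (-‖x - z i‖ ^ 2))

end

/-! The Gibbs measure is a mixture of translates of one Gaussian `γ`, of density proportional to
`exp (-‖x‖²)`, with weights `H(θᵢ) / ∑ⱼ H(θⱼ) ≥ η / p`. The log-Sobolev constant obtained depends
only on `γ`, on a lower bound for the weights and on the distances between the centres, hence not on
`θ`.

Gaussian case (`lsi_of_self_similar`). `γ` is the law of a sum of `2ⁿ` independent copies of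
`2^(-n/2) X` with `X` of law `γ`. Log-Sobolev constants, together with additive defects, add up
under convolution (`DefectiveLSI.conv`). At a small scale `r` a Taylor bound gives the constant `2
r² ∫ ‖x‖² dγ` with defect `O(r³)` (`defectiveLSI_map_smul`). Adding `2ⁿ` copies with `r² = 2⁻ⁿ`
keeps the constant bounded and sends the defect to zero. The argument runs in the class
`SlopeBound`, which is described by inequalities rather than derivatives: averaging over translates
preserves it with the same constants, and the defect is uniform on it.

Mixtures (`IsGaussianMixture.lsi`). Entropy splits into the mean of the entropies of the components
and the entropy of the component means `F(zᵢ)`. The second term is controlled by squared differences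
of `√F`, estimated by moving the centre along the segment between two centres. The squared slope of
`√F` on the way is at most the Fisher information under the intermediate Gaussian, whose density is
at most a constant times the sum of the two end densities.

Extension to all `P` (`SmoothLSI.logSobolev`). Mollification, cutoff and Fatou's lemma for the
nonnegative integrand `klFun` carry the inequality from smooth compactly supported functions to
densities with a weak gradient. The cutoff costs a factor 2.

The parameter gradient is a logarithmic derivative: `|H'| ≤ 1` bounds the numerators and `H ≥ η` the
denominator. -/

set_option linter.unusedSectionVars false

/-! ### Entropy and its quadratic upper bound. -/

section Entropy

/-- The entropy functional `∫ f log f - (∫ f) log (∫ f)`. -/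
noncomputable def entropy {α : Type*} [MeasurableSpace α] (μ : Measure α) (f : α → ℝ) : ℝ :=
  ∫ x, f x * Real.log (f x) ∂μ - (∫ x, f x ∂μ) * Real.log (∫ x, f x ∂μ)

theorem mul_log_sub_le_sq_div {t c : ℝ} (ht : 0 < t) (hc : 0 < c) :
    t * Real.log t ≤ (t - c) ^ 2 / c + t - c + t * Real.log c := by
  have h := Real.log_le_sub_one_of_pos (div_pos ht hc)
  rw [Real.log_div ht.ne' hc.ne'] at h
  have h2 := mul_le_mul_of_nonneg_left h ht.le
  have h3 : t * (t / c - 1) = (t - c) ^ 2 / c + t - c := by field_simp; ring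
  linarith

theorem sub_mul_log_le {m c : ℝ} (hm : 0 < m) (hc : 0 < c) :
    m - c + m * Real.log c ≤ m * Real.log m := by
  have h := Real.log_le_sub_one_of_pos (div_pos hc hm)
  rw [Real.log_div hc.ne' hm.ne'] at h
  have h2 := mul_le_mul_of_nonneg_left h hm.le
  have h3 : m * (c / m - 1) = c - m := by field_simp
  linarith

variable {α : Type*} [MeasurableSpace α]

theorem integrable_of_bounds {μ : Measure α} [IsFiniteMeasure μ] {f : α → ℝ} {a b : ℝ}
    (hf : AEStronglyMeasurable f μ) (h1 : ∀ x, a ≤ f x) (h2 : ∀ x, f x ≤ b) :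
    Integrable f μ :=
  Integrable.of_mem_Icc a b hf.aemeasurable (ae_of_all _ fun x => ⟨h1 x, h2 x⟩)

theorem integral_mem_bounds {μ : Measure α} [IsProbabilityMeasure μ] {f : α → ℝ} {a b : ℝ}
    (hf : AEStronglyMeasurable f μ) (h1 : ∀ x, a ≤ f x) (h2 : ∀ x, f x ≤ b) :
    a ≤ ∫ x, f x ∂μ ∧ ∫ x, f x ∂μ ≤ b := by
  have hi := integrable_of_bounds hf h1 h2
  constructor
  · simpa using integral_mono (μ := μ) (integrable_const a) hi h1
  · simpa using integral_mono (μ := μ) hi (integrable_const b) h2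

theorem integrable_mul_log_of_bounds {μ : Measure α} [IsFiniteMeasure μ] {f : α → ℝ} {a b : ℝ}
    (ha : 0 < a) (hf : Measurable f) (h1 : ∀ x, a ≤ f x) (h2 : ∀ x, f x ≤ b) :
    Integrable (fun x => f x * Real.log (f x)) μ := by
  refine integrable_of_bounds (a := -(b * |Real.log a| + b * |Real.log b|))
    (b := b * |Real.log a| + b * |Real.log b|)
    (hf.mul (Real.measurable_log.comp hf)).aestronglyMeasurable (fun x => ?_) (fun x => ?_)
  all_goals
    have hx := ha.trans_le (h1 x)
    have hb := hx.trans_le (h2 x)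
    have l1 := Real.log_le_log ha (h1 x)
    have l2 := Real.log_le_log hx (h2 x)
    have l3 : |Real.log (f x)| ≤ |Real.log a| + |Real.log b| := by
      rw [abs_le]
      constructor
      · linarith [neg_abs_le (Real.log a), abs_nonneg (Real.log b)]
      · linarith [le_abs_self (Real.log b), abs_nonneg (Real.log a)]
    have l4 : |f x * Real.log (f x)| ≤ b * |Real.log a| + b * |Real.log b| := by
      rw [abs_mul, abs_of_pos hx, ← mul_add]
      exact mul_le_mul (h2 x) l3 (abs_nonneg _) hb.le
    have := abs_le.1 l4
    linarith [this.1, this.2]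

/-- The tangent of `t log t` at `c` bounds `m log m` from below at the mean `m`, and exceeding it
costs at most `(t - c)² / c` pointwise. The linear parts cancel after integration. The freedom in
`c` allows a value of `f` at a point to replace the mean. -/
theorem entropy_le_integral_sq_div {μ : Measure α} [IsProbabilityMeasure μ] {f : α → ℝ} {a b c : ℝ}
    (ha : 0 < a) (hf : Measurable f) (h1 : ∀ x, a ≤ f x) (h2 : ∀ x, f x ≤ b) (hc : 0 < c) :
    entropy μ f ≤ ∫ x, (f x - c) ^ 2 / c ∂μ := by
  have hi := integrable_of_bounds (μ := μ) hf.aestronglyMeasurable h1 h2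
  have hm := integral_mem_bounds (μ := μ) hf.aestronglyMeasurable h1 h2
  have hsq : Integrable (fun x => (f x - c) ^ 2 / c) μ := by
    refine integrable_of_bounds (a := 0) (b := (b + c) ^ 2 / c)
      (by fun_prop) (fun x => by positivity) (fun x => ?_)
    have := ha.trans_le (h1 x)
    have hb := h2 x
    apply div_le_div_of_nonneg_right _ hc.le
    apply sq_le_sq'  <;> linarith
  have hlin : Integrable (fun x => f x * (1 + Real.log c) - c) μ :=
    (hi.mul_const _).sub (integrable_const c)
  have h3 : ∫ x, f x * Real.log (f x) ∂μ
      ≤ ∫ x, ((f x - c) ^ 2 / c + (f x * (1 + Real.log c) - c)) ∂μ :=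
    integral_mono (integrable_mul_log_of_bounds ha hf h1 h2) (hsq.add hlin) fun x => by
      have := mul_log_sub_le_sq_div (ha.trans_le (h1 x)) hc
      simp only
      linarith
  rw [integral_add hsq hlin, integral_sub (hi.mul_const _) (integrable_const c),
    integral_mul_const] at h3
  simp only [integral_const, probReal_univ, smul_eq_mul, one_mul] at h3
  have h4 := sub_mul_log_le (ha.trans_le hm.1) hc
  unfold entropy
  linarith

end Entropy

/-! ### Functions with controlled slope, and log-Sobolev inequalities under convolution. -/

section SlopeBound

variable {E : Type*} [NormedAddCommGroup E]

/-- `f` takes values in `[ε, M]` and `a` is a `K`-Lipschitz upper bound, with values in `[0, L]`,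
for the slope of `f` to first order, with a uniform second order remainder. -/
structure SlopeBound (f a : E → ℝ) (ε M L K : ℝ) : Prop where
  lower : ∀ x, ε ≤ f x
  upper : ∀ x, f x ≤ M
  slope_nonneg : ∀ x, 0 ≤ a x
  slope_le : ∀ x, a x ≤ L
  lip : ∀ x h, |f (x + h) - f x| ≤ L * ‖h‖
  slope_lip : ∀ x h, |a (x + h) - a x| ≤ K * ‖h‖
  approx : ∀ x h, |f (x + h) - f x| ≤ a x * ‖h‖ + K * ‖h‖ ^ 2

theorem continuous_of_abs_add_sub_le {f : E → ℝ} {L : ℝ}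
    (h : ∀ x h, |f (x + h) - f x| ≤ L * ‖h‖) : Continuous f := by
  refine (LipschitzWith.of_dist_le' (K := L) fun x y => ?_).continuous
  have := h y (x - y)
  rwa [add_sub_cancel, ← Real.norm_eq_abs, ← dist_eq_norm, ← dist_eq_norm] at this

namespace SlopeBound

variable {f a : E → ℝ} {ε M L K : ℝ}

theorem continuous (h : SlopeBound f a ε M L K) : Continuous f :=
  continuous_of_abs_add_sub_le h.lip

theorem continuous_slope (h : SlopeBound f a ε M L K) : Continuous a :=
  continuous_of_abs_add_sub_le h.slope_lip

theorem comp_add_right (h : SlopeBound f a ε M L K) (y : E) :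
    SlopeBound (fun x => f (x + y)) (fun x => a (x + y)) ε M L K where
  lower x := h.lower _
  upper x := h.upper _
  slope_nonneg x := h.slope_nonneg _
  slope_le x := h.slope_le _
  lip x k := by simpa [add_right_comm] using h.lip (x + y) k
  slope_lip x k := by simpa [add_right_comm] using h.slope_lip (x + y) k
  approx x k := by simpa [add_right_comm] using h.approx (x + y) k

variable [MeasurableSpace E] [BorelSpace E] [SecondCountableTopology E]

theorem integrable (h : SlopeBound f a ε M L K) (μ : Measure E) [IsFiniteMeasure μ] :
    Integrable f μ :=
  integrable_of_bounds h.continuous.aestronglyMeasurable h.lower h.upper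

theorem integrable_slope (h : SlopeBound f a ε M L K) (μ : Measure E) [IsFiniteMeasure μ] :
    Integrable a μ :=
  integrable_of_bounds h.continuous_slope.aestronglyMeasurable h.slope_nonneg h.slope_le

theorem sq_div_nonneg (h : SlopeBound f a ε M L K) (hε : 0 < ε) (x : E) : 0 ≤ a x ^ 2 / f x :=
  div_nonneg (sq_nonneg _) (hε.le.trans (h.lower x))

theorem sq_div_le (h : SlopeBound f a ε M L K) (hε : 0 < ε) (x : E) :
    a x ^ 2 / f x ≤ L ^ 2 / ε :=
  div_le_div₀ (sq_nonneg _) (pow_le_pow_left₀ (h.slope_nonneg x) (h.slope_le x) 2) hε (h.lower x)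

theorem continuous_sq_div (h : SlopeBound f a ε M L K) (hε : 0 < ε) :
    Continuous fun x => a x ^ 2 / f x :=
  (h.continuous_slope.pow 2).div h.continuous fun x => (hε.trans_le (h.lower x)).ne'

theorem integrable_sq_div (h : SlopeBound f a ε M L K) (hε : 0 < ε) (μ : Measure E)
    [IsFiniteMeasure μ] : Integrable (fun x => a x ^ 2 / f x) μ :=
  integrable_of_bounds (h.continuous_sq_div hε).aestronglyMeasurable (h.sq_div_nonneg hε)
    (h.sq_div_le hε)

theorem average (h : SlopeBound f a ε M L K) (ν : Measure E) [IsProbabilityMeasure ν] :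
    SlopeBound (fun x => ∫ y, f (x + y) ∂ν) (fun x => ∫ y, a (x + y) ∂ν) ε M L K := by
  have hf (x : E) : Integrable (fun y => f (x + y)) ν := by
    simpa only [add_comm x] using (h.comp_add_right x).integrable ν
  have ha (x : E) : Integrable (fun y => a (x + y)) ν := by
    simpa only [add_comm x] using (h.comp_add_right x).integrable_slope ν
  -- One estimate serves the last three fields: with `(u, b)` equal to `(f, L)`, `(a, K)` and `(f,
  -- a)`, and with `c` nonzero only in the third.
  have key (u b : E → ℝ) (hu : ∀ x, Integrable (fun y => u (x + y)) ν) (c : E → ℝ)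
      (hb : ∀ x, Integrable (fun y => b (x + y)) ν)
      (hub : ∀ x k, |u (x + k) - u x| ≤ b x * ‖k‖ + c k) (x k : E) :
      |∫ y, u (x + k + y) ∂ν - ∫ y, u (x + y) ∂ν| ≤ (∫ y, b (x + y) ∂ν) * ‖k‖ + c k := by
    rw [← integral_sub (hu _) (hu _)]
    refine (abs_integral_le_integral_abs).trans ?_
    have : ∫ y, (b (x + y) * ‖k‖ + c k) ∂ν = (∫ y, b (x + y) ∂ν) * ‖k‖ + c k := by
      rw [integral_add ((hb x).mul_const _) (integrable_const _), integral_mul_const]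
      simp
    rw [← this]
    refine integral_mono ((hu _).sub (hu _)).abs (((hb x).mul_const _).add (integrable_const _))
      fun y => ?_
    simpa [add_right_comm] using hub (x + y) k
  have bf (x : E) := integral_mem_bounds (μ := ν) (hf x).1 (fun y => h.lower _) (fun y => h.upper _)
  have ba (x : E) :=
    integral_mem_bounds (μ := ν) (ha x).1 (fun y => h.slope_nonneg _) (fun y => h.slope_le _)
  refine ⟨fun x => (bf x).1, fun x => (bf x).2, fun x => (ba x).1, fun x => (ba x).2, ?_, ?_, ?_⟩
  · intro x k
    simpa using key f (fun _ => L) hf 0 (fun _ => integrable_const _)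
      (by simpa using h.lip) x k
  · intro x k
    simpa using key a (fun _ => K) ha 0 (fun _ => integrable_const _)
      (by simpa using h.slope_lip) x k
  · intro x k
    exact key f a hf (fun k => K * ‖k‖ ^ 2) ha h.approx x k

/-- Jensen's inequality for the jointly convex function `(a, f) ↦ a² / f`, through its tangent `2 s
a - s² f` at `s = A / F`. -/
theorem average_sq_div_le (h : SlopeBound f a ε M L K) (hε : 0 < ε) (ν : Measure E)
    [IsProbabilityMeasure ν] (x : E) :
    (∫ y, a (x + y) ∂ν) ^ 2 / (∫ y, f (x + y) ∂ν) ≤ ∫ y, a (x + y) ^ 2 / f (x + y) ∂ν := by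
  have hx := h.comp_add_right x
  simp only [add_comm _ x] at hx
  have hF : 0 < ∫ y, f (x + y) ∂ν := hε.trans_le ((h.average ν).lower x)
  set A := ∫ y, a (x + y) ∂ν
  set F := ∫ y, f (x + y) ∂ν
  have h1 : ∫ y, (2 * (A / F) * a (x + y) - (A / F) ^ 2 * f (x + y)) ∂ν
      ≤ ∫ y, a (x + y) ^ 2 / f (x + y) ∂ν := by
    refine integral_mono (((hx.integrable_slope ν).const_mul _).sub ((hx.integrable ν).const_mul _))
      (hx.integrable_sq_div hε ν) fun y => ?_
    have hp : 0 < f (x + y) := hε.trans_le (h.lower _)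
    show _ ≤ a (x + y) ^ 2 / f (x + y)
    rw [le_div_iff₀ hp]
    nlinarith [sq_nonneg (a (x + y) - A / F * f (x + y))]
  rw [integral_sub ((hx.integrable_slope ν).const_mul _) ((hx.integrable ν).const_mul _),
    integral_const_mul, integral_const_mul] at h1
  refine le_trans (le_of_eq ?_) h1
  change A ^ 2 / F = 2 * (A / F) * A - (A / F) ^ 2 * F
  field_simp
  ring

theorem integrable_integral_mul_log (h : SlopeBound f a ε M L K) (hε : 0 < ε) (μ ν : Measure E)
    [IsProbabilityMeasure μ] [IsProbabilityMeasure ν] :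
    Integrable (fun x => ∫ y, f (x + y) * Real.log (f (x + y)) ∂ν) μ := by
  have hlog : Integrable (fun x => f x * Real.log (f x)) (μ ∗ ν) :=
    integrable_mul_log_of_bounds hε h.continuous.measurable h.lower h.upper
  have h1 := hlog
  rw [Measure.conv, integrable_map_measure hlog.1 (by fun_prop)] at h1
  exact h1.integral_prod_left

theorem integrable_average_mul_log (h : SlopeBound f a ε M L K) (hε : 0 < ε) (μ ν : Measure E)
    [IsProbabilityMeasure μ] [IsProbabilityMeasure ν] :
    Integrable (fun x => (∫ y, f (x + y) ∂ν) * Real.log (∫ y, f (x + y) ∂ν)) μ :=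
  have hA := h.average ν
  integrable_mul_log_of_bounds hε hA.continuous.measurable hA.lower hA.upper

theorem integrable_entropy (h : SlopeBound f a ε M L K) (hε : 0 < ε) (μ ν : Measure E)
    [IsProbabilityMeasure μ] [IsProbabilityMeasure ν] :
    Integrable (fun x => entropy ν (fun y => f (x + y))) μ :=
  (h.integrable_integral_mul_log hε μ ν).sub (h.integrable_average_mul_log hε μ ν)

/-- Chain rule for entropy: the terms `F log F` of the conditional means `F` cancel. -/
theorem entropy_conv (h : SlopeBound f a ε M L K) (hε : 0 < ε) (μ ν : Measure E)
    [IsProbabilityMeasure μ] [IsProbabilityMeasure ν] :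
    entropy (μ ∗ ν) f
      = ∫ x, entropy ν (fun y => f (x + y)) ∂μ + entropy μ (fun x => ∫ y, f (x + y) ∂ν) := by
  unfold entropy
  rw [integral_conv (integrable_mul_log_of_bounds hε h.continuous.measurable h.lower h.upper),
    integral_conv (h.integrable _), integral_sub (h.integrable_integral_mul_log hε μ ν)
      (h.integrable_average_mul_log hε μ ν)]
  ring

end SlopeBound

variable [MeasurableSpace E]

/-- The log-Sobolev inequality with constant `C` and defect `e` on a class of functions. -/
def DefectiveLSI (μ : Measure E) (ε M L K C e : ℝ) : Prop :=
  ∀ f a : E → ℝ, SlopeBound f a ε M L K → entropy μ f ≤ C * ∫ x, a x ^ 2 / f x ∂μ + e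

variable [BorelSpace E] [SecondCountableTopology E]

/-- In the chain rule, `hν` applies to each translate of `f` and `hμ` to the average of `f` over
`ν`, which stays in the same class; Jensen's inequality returns to `a² / f` under `μ ∗ ν`. -/
theorem DefectiveLSI.conv {μ ν : Measure E} [IsProbabilityMeasure μ] [IsProbabilityMeasure ν]
    {ε M L K C C' e e' : ℝ} (hε : 0 < ε) (hC : 0 ≤ C) (hμ : DefectiveLSI μ ε M L K C e)
    (hν : DefectiveLSI ν ε M L K C' e') :
    DefectiveLSI (μ ∗ ν) ε M L K (C + C') (e + e') := by
  intro f a h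
  have hA := h.average ν
  have hi := h.integrable_sq_div hε (μ ∗ ν)
  have hi2 : Integrable (fun x => ∫ y, a (x + y) ^ 2 / f (x + y) ∂ν) μ := by
    have := hi
    rw [Measure.conv, integrable_map_measure hi.1 (by fun_prop)] at this
    exact this.integral_prod_left
  rw [h.entropy_conv hε, integral_conv hi]
  have h1 := hμ _ _ hA
  have h2 : ∫ x, (∫ y, a (x + y) ∂ν) ^ 2 / (∫ y, f (x + y) ∂ν) ∂μ
      ≤ ∫ x, ∫ y, a (x + y) ^ 2 / f (x + y) ∂ν ∂μ :=
    integral_mono (hA.integrable_sq_div hε μ) hi2 (h.average_sq_div_le hε ν)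
  have h3 : ∫ x, entropy ν (fun y => f (x + y)) ∂μ
      ≤ ∫ x, (C' * (∫ y, a (x + y) ^ 2 / f (x + y) ∂ν) + e') ∂μ := by
    refine integral_mono (h.integrable_entropy hε μ ν) ((hi2.const_mul _).add
      (integrable_const _)) fun x => ?_
    have hx := h.comp_add_right x
    simp only [add_comm _ x] at hx
    exact hν _ _ hx
  rw [integral_add (hi2.const_mul _) (integrable_const _), integral_const_mul] at h3
  simp only [integral_const, probReal_univ, smul_eq_mul, one_mul] at h3
  nlinarith [mul_le_mul_of_nonneg_left h2 hC]

end SlopeBound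

/-! ### Log-Sobolev inequality for a self-similar measure. -/

section SelfSimilar

variable {E : Type*} [NormedAddCommGroup E]

/-- The Lipschitz constant involves only the parameters of the class, so exchanging `a² / f` at a
point for its average near that point costs a uniform error. -/
theorem SlopeBound.sq_div_sub_le {f a : E → ℝ} {ε M L K : ℝ} (h : SlopeBound f a ε M L K)
    (hε : 0 < ε) (x k : E) :
    a x ^ 2 / f x - a (x + k) ^ 2 / f (x + k) ≤ (2 * L * K / ε + L ^ 3 / ε ^ 2) * ‖k‖ := by
  have p0 := hε.trans_le (h.lower x)
  have p1 := hε.trans_le (h.lower (x + k))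
  have hL := (h.slope_nonneg x).trans (h.slope_le x)
  have e1 : a x ^ 2 / f x - a (x + k) ^ 2 / f (x + k)
      = (a x ^ 2 - a (x + k) ^ 2) / f x
        + a (x + k) ^ 2 * (f (x + k) - f x) / (f x * f (x + k)) := by
    field_simp
    ring
  have e2 : (a x ^ 2 - a (x + k) ^ 2) / f x ≤ 2 * L * (K * ‖k‖) / ε := by
    have h1 : a x ^ 2 - a (x + k) ^ 2 ≤ 2 * L * (K * ‖k‖) := by
      calc a x ^ 2 - a (x + k) ^ 2 = (a x + a (x + k)) * -(a (x + k) - a x) := by ring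
        _ ≤ (a x + a (x + k)) * |a (x + k) - a x| :=
          mul_le_mul_of_nonneg_left (neg_le_abs _)
            (add_nonneg (h.slope_nonneg _) (h.slope_nonneg _))
        _ ≤ 2 * L * (K * ‖k‖) :=
          mul_le_mul (by linarith [h.slope_le x, h.slope_le (x + k)]) (h.slope_lip x k)
            (abs_nonneg _) (by linarith)
    have h2 : 0 ≤ 2 * L * (K * ‖k‖) :=
      mul_nonneg (by linarith) ((abs_nonneg _).trans (h.slope_lip x k))
    calc _ ≤ 2 * L * (K * ‖k‖) / f x := by gcongr
      _ ≤ _ := by gcongr; exact h.lower x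
  have e3 : a (x + k) ^ 2 * (f (x + k) - f x) / (f x * f (x + k)) ≤ L ^ 2 * (L * ‖k‖) / (ε * ε) := by
    apply div_le_div₀ (by positivity) _ (by positivity)
      (mul_le_mul (h.lower _) (h.lower _) hε.le p0.le)
    calc a (x + k) ^ 2 * (f (x + k) - f x) ≤ a (x + k) ^ 2 * (L * ‖k‖) :=
          mul_le_mul_of_nonneg_left ((le_abs_self _).trans (h.lip x k)) (sq_nonneg _)
      _ ≤ _ := by
        gcongr
        · exact h.slope_nonneg _
        · exact h.slope_le _
  calc _ ≤ 2 * L * (K * ‖k‖) / ε + L ^ 2 * (L * ‖k‖) / (ε * ε) := by rw [e1]; linarith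
    _ = _ := by field_simp

variable [InnerProductSpace ℝ E] [MeasurableSpace E] [BorelSpace E] [SecondCountableTopology E]

/-- The quadratic entropy bound with `c = f 0` and the first order expansion of `f` at `0` leave
`a(0)² / f(0)`, which is then compared with its average. Both errors are `O(r³)`, which is `o(r²)`
as the iteration needs. -/
theorem defectiveLSI_map_smul {γ : Measure E} [IsProbabilityMeasure γ]
    (h4 : Integrable (fun x => ‖x‖ ^ 4) γ) (h2 : Integrable (fun x => ‖x‖ ^ 2) γ)
    (h1 : Integrable (fun x => ‖x‖) γ) {ε M L K r : ℝ} (hε : 0 < ε) (hr : 0 ≤ r) :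
    DefectiveLSI (γ.map (r • ·)) ε M L K (2 * (∫ x, ‖x‖ ^ 2 ∂γ) * r ^ 2)
      (r ^ 2 * (2 * (∫ x, ‖x‖ ^ 2 ∂γ) * ((2 * L * K / ε + L ^ 3 / ε ^ 2) * (r * ∫ x, ‖x‖ ∂γ))
        + 2 * K ^ 2 / ε * (r ^ 2 * ∫ x, ‖x‖ ^ 4 ∂γ))) := by
  intro f a h
  have hmeas : Measurable (fun x : E => r • x) := measurable_const_smul r
  have : IsProbabilityMeasure (γ.map (r • ·)) := Measure.isProbabilityMeasure_map hmeas.aemeasurable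
  have p0 : 0 < f 0 := hε.trans_le (h.lower 0)
  set m1 := ∫ x, ‖x‖ ∂γ
  set m2 := ∫ x, ‖x‖ ^ 2 ∂γ
  set m4 := ∫ x, ‖x‖ ^ 4 ∂γ
  set D := 2 * L * K / ε + L ^ 3 / ε ^ 2
  have hm2 : 0 ≤ m2 := integral_nonneg fun x => by positivity
  have hm4 : 0 ≤ m4 := integral_nonneg fun x => by positivity
  have s1 : entropy (γ.map (r • ·)) f ≤ ∫ x, (f (r • x) - f 0) ^ 2 / f 0 ∂γ := by
    refine (entropy_le_integral_sq_div hε h.continuous.measurable h.lower h.upper p0).trans_eq ?_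
    rw [integral_map hmeas.aemeasurable]
    exact (((h.continuous.sub continuous_const).pow 2).div_const _).aestronglyMeasurable
  have s2 : ∫ x, (f (r • x) - f 0) ^ 2 / f 0 ∂γ
      ≤ ∫ x, (2 * r ^ 2 * (a 0 ^ 2 / f 0) * ‖x‖ ^ 2 + 2 * K ^ 2 / ε * r ^ 4 * ‖x‖ ^ 4) ∂γ := by
    refine integral_mono_of_nonneg (ae_of_all _ fun x => by positivity)
      ((h2.const_mul _).add (h4.const_mul _)) (ae_of_all _ fun x => ?_)
    have ha := h.approx 0 (r • x)
    rw [zero_add, norm_smul, Real.norm_of_nonneg hr] at ha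
    -- The factor 2 in the final constant comes from `(s + t)² ≤ 2 s² + 2 t²`.
    have hb : (f (r • x) - f 0) ^ 2 ≤ 2 * (a 0 * (r * ‖x‖)) ^ 2 + 2 * (K * (r * ‖x‖) ^ 2) ^ 2 := by
      calc (f (r • x) - f 0) ^ 2 = |f (r • x) - f 0| ^ 2 := (sq_abs _).symm
        _ ≤ (a 0 * (r * ‖x‖) + K * (r * ‖x‖) ^ 2) ^ 2 := pow_le_pow_left₀ (abs_nonneg _) ha 2
        _ ≤ _ := add_sq_le.trans_eq (by ring)
    calc (f (r • x) - f 0) ^ 2 / f 0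
        ≤ (2 * (a 0 * (r * ‖x‖)) ^ 2 + 2 * (K * (r * ‖x‖) ^ 2) ^ 2) / f 0 := by gcongr
      _ = 2 * r ^ 2 * (a 0 ^ 2 / f 0) * ‖x‖ ^ 2 + 2 * K ^ 2 / f 0 * r ^ 4 * ‖x‖ ^ 4 := by
        field_simp
      _ ≤ 2 * r ^ 2 * (a 0 ^ 2 / f 0) * ‖x‖ ^ 2 + 2 * K ^ 2 / ε * r ^ 4 * ‖x‖ ^ 4 := by
        gcongr
        exact h.lower 0
  rw [integral_add (h2.const_mul _) (h4.const_mul _), integral_const_mul, integral_const_mul] at s2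
  have s3 : a 0 ^ 2 / f 0 - ∫ x, a x ^ 2 / f x ∂(γ.map (r • ·)) ≤ D * (r * m1) := by
    have hi := h.integrable_sq_div hε (γ.map (r • ·))
    have hi' : Integrable (fun x => a (r • x) ^ 2 / f (r • x)) γ := by
      have := hi
      rwa [integrable_map_measure hi.1 hmeas.aemeasurable] at this
    rw [integral_map hmeas.aemeasurable hi.1]
    have : a 0 ^ 2 / f 0 - ∫ x, a (r • x) ^ 2 / f (r • x) ∂γ
        = ∫ x, (a 0 ^ 2 / f 0 - a (r • x) ^ 2 / f (r • x)) ∂γ := by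
      rw [integral_sub (integrable_const _) hi']
      simp
    rw [this, ← integral_const_mul, ← integral_const_mul]
    refine integral_mono ((integrable_const _).sub hi') ((h1.const_mul _).const_mul _) fun x => ?_
    have := h.sq_div_sub_le hε 0 (r • x)
    rwa [zero_add, norm_smul, Real.norm_of_nonneg hr] at this
  calc _ ≤ 2 * r ^ 2 * (a 0 ^ 2 / f 0) * m2 + 2 * K ^ 2 / ε * r ^ 4 * m4 := s1.trans s2
    _ = 2 * m2 * r ^ 2 * (a 0 ^ 2 / f 0) + 2 * K ^ 2 / ε * r ^ 4 * m4 := by ring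
    _ ≤ 2 * m2 * r ^ 2 * (∫ x, a x ^ 2 / f x ∂(γ.map (r • ·)) + D * (r * m1))
        + 2 * K ^ 2 / ε * r ^ 4 * m4 := by gcongr; linarith
    _ = _ := by ring

theorem map_smul_conv_map_smul {γ : Measure E} [IsProbabilityMeasure γ] {s : ℝ}
    (hγ : γ.map (s • ·) ∗ γ.map (s • ·) = γ) (r : ℝ) :
    γ.map ((r * s) • ·) ∗ γ.map ((r * s) • ·) = γ.map (r • ·) := by
  have hmeas (t : ℝ) : Measurable (fun x : E => t • x) := measurable_const_smul t
  have (t : ℝ) : IsProbabilityMeasure (γ.map (t • ·)) :=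
    Measure.isProbabilityMeasure_map (hmeas t).aemeasurable
  have e (t : ℝ) : γ.map ((r * t) • ·) = (γ.map (t • ·)).map (r • ContinuousLinearMap.id ℝ E) := by
    rw [Measure.map_map (by fun_prop) (hmeas t)]
    congr 1
    ext x
    simp [mul_smul]
  rw [e, ← Measure.map_conv_continuousLinearMap, hγ]
  rfl

/-- Convolving two copies at scale `r s` gives scale `r` and doubles both the constant and the
defect. -/
theorem DefectiveLSI.of_map_smul_pow {γ : Measure E} [IsProbabilityMeasure γ] {s : ℝ}
    (hγ : γ.map (s • ·) ∗ γ.map (s • ·) = γ) {ε M L K : ℝ} (hε : 0 < ε) (n : ℕ) :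
    ∀ r C e : ℝ, 0 ≤ C → DefectiveLSI (γ.map ((r * s ^ n) • ·)) ε M L K C e →
      DefectiveLSI (γ.map (r • ·)) ε M L K (2 ^ n * C) (2 ^ n * e) := by
  induction n with
  | zero => intro r C e _ h; simpa using h
  | succ n ih =>
    intro r C e hC h
    have (t : ℝ) : IsProbabilityMeasure (γ.map (t • ·)) :=
      Measure.isProbabilityMeasure_map (measurable_const_smul t).aemeasurable
    rw [pow_succ, ← mul_assoc] at h
    have h2 := h.conv hε hC h
    rw [map_smul_conv_map_smul hγ] at h2
    have h3 := ih r (C + C) (e + e) (by positivity) h2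
    convert h3 using 1 <;> ring

theorem lsi_of_self_similar {γ : Measure E} [IsProbabilityMeasure γ] {s : ℝ} (hs0 : 0 ≤ s)
    (hs : 2 * s ^ 2 = 1) (hγ : γ.map (s • ·) ∗ γ.map (s • ·) = γ)
    (h4 : Integrable (fun x => ‖x‖ ^ 4) γ) (h2 : Integrable (fun x => ‖x‖ ^ 2) γ)
    (h1 : Integrable (fun x => ‖x‖) γ) {ε M L K : ℝ} (hε : 0 < ε) {f a : E → ℝ}
    (h : SlopeBound f a ε M L K) :
    entropy γ f ≤ 2 * (∫ x, ‖x‖ ^ 2 ∂γ) * ∫ x, a x ^ 2 / f x ∂γ := by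
  set m2 := ∫ x, ‖x‖ ^ 2 ∂γ
  have hm2 : 0 ≤ m2 := integral_nonneg fun x => by positivity
  have hs1 : s < 1 := by nlinarith
  have key (n : ℕ) : entropy γ f ≤ 2 * m2 * ∫ x, a x ^ 2 / f x ∂γ
      + (2 * m2 * ((2 * L * K / ε + L ^ 3 / ε ^ 2) * (s ^ n * ∫ x, ‖x‖ ∂γ))
        + 2 * K ^ 2 / ε * ((s ^ n) ^ 2 * ∫ x, ‖x‖ ^ 4 ∂γ)) := by
    have hb := defectiveLSI_map_smul h4 h2 h1 (M := M) (L := L) (K := K) hε (pow_nonneg hs0 n)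
    rw [← one_mul (s ^ n)] at hb
    -- The factor `2ⁿ` cancels the `(sⁿ)²` in the constant and in the defect; what remains of the
    -- defect tends to zero with `sⁿ`.
    have h3 := DefectiveLSI.of_map_smul_pow hγ hε n 1 _ _ (by positivity) hb
    have h4 := h3 f a (by simpa using h)
    have e1 : (2 : ℝ) ^ n * (s ^ n) ^ 2 = 1 := by
      rw [← pow_mul, mul_comm n 2, pow_mul, ← mul_pow, hs, one_pow]
    simp only [one_smul, one_mul, Measure.map_id'] at h4
    refine h4.trans_eq ?_
    rw [show ∀ A X Y : ℝ, 2 ^ n * (A * (s ^ n) ^ 2) * X + 2 ^ n * ((s ^ n) ^ 2 * Y)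
      = (2 ^ n * (s ^ n) ^ 2) * (A * X + Y) by intros; ring, e1, one_mul]
  have ht := tendsto_pow_atTop_nhds_zero_of_lt_one hs0 hs1
  have hlim : Filter.Tendsto (fun n => 2 * m2 * ∫ x, a x ^ 2 / f x ∂γ
      + (2 * m2 * ((2 * L * K / ε + L ^ 3 / ε ^ 2) * (s ^ n * ∫ x, ‖x‖ ∂γ))
        + 2 * K ^ 2 / ε * ((s ^ n) ^ 2 * ∫ x, ‖x‖ ^ 4 ∂γ))) Filter.atTop
      (nhds (2 * m2 * ∫ x, a x ^ 2 / f x ∂γ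
      + (2 * m2 * ((2 * L * K / ε + L ^ 3 / ε ^ 2) * (0 * ∫ x, ‖x‖ ∂γ))
        + 2 * K ^ 2 / ε * (0 ^ 2 * ∫ x, ‖x‖ ^ 4 ∂γ)))) :=
    (((ht.mul_const _).const_mul _).const_mul _ |>.add
      (((ht.pow 2).mul_const _).const_mul _)).const_add _
  have := ge_of_tendsto' hlim key
  simpa using this

end SelfSimilar

/-! ### The Gaussian measure: characteristic function, self-similarity, moments. -/

section Gaussian

variable (E : Type*) [NormedAddCommGroup E] [InnerProductSpace ℝ E] [FiniteDimensional ℝ E]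
  [MeasurableSpace E] [BorelSpace E]

/-- The probability measure with density proportional to `exp (-‖x‖ ^ 2)`. -/
noncomputable def halfGaussian : Measure E := (volume : Measure E).tilted (fun x => -‖x‖ ^ 2)

theorem integrable_exp_neg_sq_norm : Integrable (fun x : E => Real.exp (-‖x‖ ^ 2)) := by
  have h := (GaussianFourier.integrable_cexp_neg_mul_sq_norm_add (V := E) (b := 1)
    (by simp) 0 0).norm
  refine h.congr (ae_of_all _ fun x => ?_)
  simp only [Complex.norm_exp]
  congr 1
  simp [← Complex.ofReal_pow]

instance : IsProbabilityMeasure (halfGaussian E) :=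
  isProbabilityMeasure_tilted (integrable_exp_neg_sq_norm E)

theorem charFun_halfGaussian (t : E) :
    charFun (halfGaussian E) t = Complex.exp (-‖t‖ ^ 2 / 4) := by
  have hZ := GaussianFourier.integral_cexp_neg_mul_sq_norm (V := E) (b := 1) (by simp)
  have hI := GaussianFourier.integral_cexp_neg_mul_sq_norm_add (V := E) (b := 1) (by simp)
    Complex.I t
  have hZ2 : ((∫ x : E, Real.exp (-‖x‖ ^ 2) : ℝ) : ℂ)
      = (Real.pi / 1 : ℂ) ^ (Module.finrank ℝ E / 2 : ℂ) := by
    rw [← hZ, ← integral_complex_ofReal]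
    simp
  have hpos : 0 < ∫ x : E, Real.exp (-‖x‖ ^ 2) := integral_exp_pos (integrable_exp_neg_sq_norm E)
  rw [charFun_apply, halfGaussian, integral_tilted]
  have : ∀ x : E, (Real.exp (-‖x‖ ^ 2) / ∫ x : E, Real.exp (-‖x‖ ^ 2)) •
      Complex.exp (inner ℝ x t * Complex.I)
      = ((∫ x : E, Real.exp (-‖x‖ ^ 2) : ℝ) : ℂ)⁻¹ *
        Complex.exp (-1 * ‖x‖ ^ 2 + Complex.I * inner ℝ t x) := by
    intro x
    rw [Complex.exp_add, Complex.real_smul, real_inner_comm]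
    push_cast
    ring_nf
  simp_rw [this]
  rw [integral_const_mul, hI, hZ2, ← mul_assoc, inv_mul_cancel₀, one_mul]
  · congr 1
    simp
  · rw [← hZ2]
    exact_mod_cast hpos.ne'

theorem halfGaussian_self_similar :
    (halfGaussian E).map ((√2)⁻¹ • ·) ∗ (halfGaussian E).map ((√2)⁻¹ • ·) = halfGaussian E := by
  have : IsProbabilityMeasure ((halfGaussian E).map ((√2)⁻¹ • ·)) :=
    Measure.isProbabilityMeasure_map (measurable_const_smul _).aemeasurable
  apply Measure.ext_of_charFun
  ext t
  rw [charFun_conv, charFun_map_smul, charFun_halfGaussian, charFun_halfGaussian, norm_smul,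
    ← Complex.exp_add]
  congr 1
  have : (((√2 : ℝ) : ℂ)⁻¹) ^ 2 = 1 / 2 := by
    rw [inv_pow, ← Complex.ofReal_pow, Real.sq_sqrt (by norm_num)]
    norm_num
  rw [Real.norm_of_nonneg (by positivity)]
  push_cast
  rw [mul_pow, this]
  ring

open ProbabilityTheory in
-- This identification transfers finiteness of moments from the general theory of Gaussian measures.
theorem halfGaussian_eq_map_stdGaussian :
    halfGaussian E = (stdGaussian E).map ((√2)⁻¹ • ContinuousLinearMap.id ℝ E) := by
  apply Measure.ext_of_charFun
  ext t
  have := charFun_map_smul (μ := stdGaussian E) (√2)⁻¹ t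
  change charFun _ t = charFun ((stdGaussian E).map ((√2)⁻¹ • ·)) t
  rw [this, charFun_halfGaussian, charFun_stdGaussian, norm_smul]
  congr 1
  have : (((√2 : ℝ) : ℂ)⁻¹) ^ 2 = 1 / 2 := by
    rw [inv_pow, ← Complex.ofReal_pow, Real.sq_sqrt (by norm_num)]
    norm_num
  rw [Real.norm_of_nonneg (by positivity)]
  push_cast
  rw [mul_pow, this]
  ring

open ProbabilityTheory in
theorem integrable_norm_pow_halfGaussian (n : ℕ) :
    Integrable (fun x => ‖x‖ ^ n) (halfGaussian E) := by
  rw [halfGaussian_eq_map_stdGaussian]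
  have := IsGaussian.memLp_id
    ((stdGaussian E).map ((√2)⁻¹ • ContinuousLinearMap.id ℝ E)) n (by simp)
  exact this.integrable_norm_pow'

variable {E} in
/-- The logarithmic Sobolev inequality for the Gaussian measure. -/
theorem lsi_halfGaussian {ε M L K : ℝ} (hε : 0 < ε) {f a : E → ℝ} (h : SlopeBound f a ε M L K) :
    entropy (halfGaussian E) f
      ≤ 2 * (∫ x, ‖x‖ ^ 2 ∂(halfGaussian E)) * ∫ x, a x ^ 2 / f x ∂(halfGaussian E) :=
  lsi_of_self_similar (s := (√2)⁻¹) (by positivity)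
    (by rw [inv_pow, Real.sq_sqrt (by norm_num)]; norm_num) (halfGaussian_self_similar E)
    (integrable_norm_pow_halfGaussian E 4) (integrable_norm_pow_halfGaussian E 2)
    (by simpa using integrable_norm_pow_halfGaussian E 1) hε h

end Gaussian

/-! ### Gaussian averages as the centre moves along a segment. -/

section Translates

variable {E : Type*} [NormedAddCommGroup E] [InnerProductSpace ℝ E]

/-- The squared distance to the intermediate point is the convex combination of those to the end
points minus `t (1 - t) ‖v‖²`, hence at least their minimum minus `‖v‖² / 4`. -/
theorem exp_neg_sq_norm_segment_le (z v x : E) {t : ℝ} (ht0 : 0 ≤ t) (ht1 : t ≤ 1) :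
    Real.exp (-‖x - (z + t • v)‖ ^ 2)
      ≤ Real.exp (‖v‖ ^ 2 / 4) * (Real.exp (-‖x - z‖ ^ 2) + Real.exp (-‖x - (z + v)‖ ^ 2)) := by
  set y := x - z with hy
  have e1 : x - (z + t • v) = y - t • v := by rw [hy]; abel
  have e2 : x - (z + v) = y - v := by rw [hy]; abel
  rw [e1, e2]
  have n1 : ‖y - t • v‖ ^ 2 = ‖y‖ ^ 2 - 2 * t * inner ℝ y v + t ^ 2 * ‖v‖ ^ 2 := by
    rw [norm_sub_sq_real, inner_smul_right, norm_smul, Real.norm_of_nonneg ht0]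
    ring
  have n2 : ‖y - v‖ ^ 2 = ‖y‖ ^ 2 - 2 * inner ℝ y v + ‖v‖ ^ 2 := norm_sub_sq_real y v
  have n3 : ‖y - t • v‖ ^ 2
      = (1 - t) * ‖y‖ ^ 2 + t * ‖y - v‖ ^ 2 - t * (1 - t) * ‖v‖ ^ 2 := by
    rw [n1, n2]; ring
  have n4 : t * (1 - t) * ‖v‖ ^ 2 ≤ ‖v‖ ^ 2 / 4 := by
    nlinarith [mul_nonneg (sq_nonneg (t - 1 / 2)) (sq_nonneg ‖v‖)]
  rw [mul_add, ← Real.exp_add, ← Real.exp_add]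
  rcases le_total (‖y‖ ^ 2) (‖y - v‖ ^ 2) with h | h
  · refine le_add_of_le_of_nonneg (Real.exp_le_exp.2 ?_) (Real.exp_pos _).le
    nlinarith
  · refine le_add_of_nonneg_of_le (Real.exp_pos _).le (Real.exp_le_exp.2 ?_)
    nlinarith

/-- A mean value inequality without derivatives: the segment is cut into equal pieces, each with an
error quadratic in its length, so the total error vanishes as the pieces shrink. -/
theorem SlopeBound.abs_sqrt_sub_sqrt_le {F A : E → ℝ} {ε M L K B : ℝ}
    (h : SlopeBound F A ε M L K) (hε : 0 < ε) (z v : E)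
    (hA : ∀ t : ℝ, 0 ≤ t → t ≤ 1 → A (z + t • v) ≤ B * √(F (z + t • v))) :
    |√(F (z + v)) - √(F z)| ≤ ‖v‖ * B := by
  have hF (x : E) : 0 < F x := hε.trans_le (h.lower x)
  have step (t s : ℝ) (ht0 : 0 ≤ t) (ht1 : t ≤ 1) (hs : 0 ≤ s) :
      |√(F (z + (t + s) • v)) - √(F (z + t • v))|
        ≤ s * (‖v‖ * B) + s ^ 2 * (|K| * ‖v‖ ^ 2 / √ε) := by
    set x := z + t • v with hx
    have e : z + (t + s) • v = x + s • v := by rw [hx, add_smul, add_assoc]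
    rw [e]
    have p1 := Real.sqrt_pos.2 (hF x)
    have p2 := Real.sqrt_pos.2 (hF (x + s • v))
    have pε := Real.sqrt_pos.2 hε
    have q1 : √ε ≤ √(F x) := Real.sqrt_le_sqrt (h.lower x)
    have h1 := h.approx x (s • v)
    rw [norm_smul, Real.norm_of_nonneg hs] at h1
    -- Dropping `√(F (x + s • v))` from the sum of roots loses a factor 2 in the slope of `√F`.
    have h2 : |√(F (x + s • v)) - √(F x)| * √(F x) ≤ |F (x + s • v) - F x| := by
      calc _ ≤ |√(F (x + s • v)) - √(F x)| * (√(F (x + s • v)) + √(F x)) := by gcongr; linarith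
        _ = |(√(F (x + s • v)) - √(F x)) * (√(F (x + s • v)) + √(F x))| := by
          rw [abs_mul, abs_of_pos (add_pos p2 p1)]
        _ = _ := by
          congr 1
          linear_combination Real.sq_sqrt (hF (x + s • v)).le - Real.sq_sqrt (hF x).le
    have h3 : A x * (s * ‖v‖) ≤ B * √(F x) * (s * ‖v‖) :=
      mul_le_mul_of_nonneg_right (hA t ht0 ht1) (by positivity)
    have h4 : K * (s * ‖v‖) ^ 2 ≤ s ^ 2 * (|K| * ‖v‖ ^ 2 / √ε) * √(F x) := by
      calc K * (s * ‖v‖) ^ 2 ≤ |K| * (s * ‖v‖) ^ 2 := by gcongr; exact le_abs_self K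
        _ = s ^ 2 * (|K| * ‖v‖ ^ 2 / √ε) * √ε := by field_simp
        _ ≤ _ := by gcongr
    refine le_of_mul_le_mul_right ?_ p1
    calc _ ≤ A x * (s * ‖v‖) + K * (s * ‖v‖) ^ 2 := h2.trans h1
      _ ≤ _ := by linarith
  have sum (N : ℕ) (hN : 0 < N) (k : ℕ) (hk : k ≤ N) :
      |√(F (z + ((k : ℝ) / N) • v)) - √(F z)|
        ≤ k * (1 / N * (‖v‖ * B) + (1 / N) ^ 2 * (|K| * ‖v‖ ^ 2 / √ε)) := by
    have hN' : (0 : ℝ) < N := by exact_mod_cast hN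
    induction k with
    | zero => simp
    | succ k ih =>
      have h1 := ih (by omega)
      have h2 := step (k / N) (1 / N) (by positivity)
        ((div_le_one hN').2 (by exact_mod_cast (by omega : k ≤ N))) (by positivity)
      have e : ((k + 1 : ℕ) : ℝ) / N = k / N + 1 / N := by push_cast; ring
      rw [e]
      have h3 := abs_sub_le (√(F (z + ((k : ℝ) / N + 1 / N) • v))) (√(F (z + ((k : ℝ) / N) • v)))
        (√(F z))
      push_cast
      linarith
  have fin (N : ℕ) : |√(F (z + v)) - √(F z)|
      ≤ ‖v‖ * B + 1 / ((N : ℝ) + 1) * (|K| * ‖v‖ ^ 2 / √ε) := by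
    have h1 := sum (N + 1) (by omega) (N + 1) le_rfl
    push_cast at h1
    have h0 : (N : ℝ) + 1 ≠ 0 := by positivity
    rw [div_self h0, one_smul] at h1
    refine h1.trans_eq ?_
    field_simp
  have hl : Filter.Tendsto (fun N : ℕ => ‖v‖ * B + 1 / ((N : ℝ) + 1) * (|K| * ‖v‖ ^ 2 / √ε))
      Filter.atTop (nhds (‖v‖ * B + 0 * (|K| * ‖v‖ ^ 2 / √ε))) :=
    (tendsto_one_div_add_atTop_nhds_zero_nat.mul_const _).const_add _
  simpa using ge_of_tendsto' hl fin

variable [FiniteDimensional ℝ E] [MeasurableSpace E] [BorelSpace E]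

theorem integral_add_halfGaussian (g : E → ℝ) (z : E) :
    ∫ x, g (x + z) ∂(halfGaussian E)
      = (∫ x : E, Real.exp (-‖x‖ ^ 2))⁻¹ * ∫ x, Real.exp (-‖x - z‖ ^ 2) * g x := by
  rw [halfGaussian, integral_tilted,
    ← integral_add_right_eq_self (fun x => Real.exp (-‖x - z‖ ^ 2) * g x) z, ← integral_const_mul]
  congr 1
  ext x
  simp only [add_sub_cancel_right, smul_eq_mul]
  ring

theorem integrable_exp_neg_sq_norm_sub (z : E) :
    Integrable (fun x : E => Real.exp (-‖x - z‖ ^ 2)) :=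
  (integrable_exp_neg_sq_norm E).comp_sub_right z

theorem integral_add_segment_le {g : E → ℝ} {b : ℝ} (hg : Continuous g) (h0 : ∀ x, 0 ≤ g x)
    (hb : ∀ x, g x ≤ b) (z v : E) {t : ℝ} (ht0 : 0 ≤ t) (ht1 : t ≤ 1) :
    ∫ x, g (x + (z + t • v)) ∂(halfGaussian E) ≤ Real.exp (‖v‖ ^ 2 / 4) *
      (∫ x, g (x + z) ∂(halfGaussian E) + ∫ x, g (x + (z + v)) ∂(halfGaussian E)) := by
  have hi (y : E) : Integrable (fun x : E => Real.exp (-‖x - y‖ ^ 2) * g x) :=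
    (integrable_exp_neg_sq_norm_sub y).mul_bdd (c := b) hg.aestronglyMeasurable
      (ae_of_all _ fun x => by rw [Real.norm_of_nonneg (h0 x)]; exact hb x)
  rw [integral_add_halfGaussian, integral_add_halfGaussian, integral_add_halfGaussian, ← mul_add,
    mul_left_comm, ← integral_add (hi _) (hi _)]
  have hZ : 0 ≤ (∫ x : E, Real.exp (-‖x‖ ^ 2))⁻¹ :=
    inv_nonneg.2 (integral_nonneg fun x => (Real.exp_pos _).le)
  refine mul_le_mul_of_nonneg_left ?_ hZ
  rw [← integral_const_mul]
  refine integral_mono (hi _) (((hi _).add (hi _)).const_mul _) fun x => ?_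
  have := mul_le_mul_of_nonneg_right (exp_neg_sq_norm_segment_le z v x ht0 ht1) (h0 x)
  simp only
  linarith

end Translates

/-! ### Log-Sobolev inequality for Gaussian mixtures. -/

section Mixture

variable {E : Type*} [NormedAddCommGroup E] [InnerProductSpace ℝ E] [FiniteDimensional ℝ E]
  [MeasurableSpace E] [BorelSpace E] {ι : Type*} [Fintype ι]

/-- `Q` is the mixture with weights `w` of the Gaussian measures centred at the points `z i`. -/
structure IsGaussianMixture (Q : Measure E) (w : ι → ℝ) (z : ι → E) : Prop where
  sum_eq_one : ∑ i, w i = 1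
  integral_eq : ∀ (f : E → ℝ) (a b : ℝ), Continuous f → (∀ x, a ≤ f x) → (∀ x, f x ≤ b) →
    ∫ x, f x ∂Q = ∑ i, w i * ∫ x, f (x + z i) ∂(halfGaussian E)

theorem IsGaussianMixture.integral_add_le {Q : Measure E} {w : ι → ℝ} {z : ι → E}
    (hQ : IsGaussianMixture Q w z) {κ : ℝ} (hκ : 0 < κ) (hw : ∀ i, κ ≤ w i) {g : E → ℝ} {b : ℝ}
    (hg : Continuous g) (h0 : ∀ x, 0 ≤ g x) (hb : ∀ x, g x ≤ b) (i : ι) :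
    ∫ x, g (x + z i) ∂(halfGaussian E) ≤ κ⁻¹ * ∫ x, g x ∂Q := by
  rw [le_inv_mul_iff₀ hκ, hQ.integral_eq g 0 b hg h0 hb]
  have hn (j : ι) : 0 ≤ ∫ x, g (x + z j) ∂(halfGaussian E) := integral_nonneg fun x => h0 _
  calc _ ≤ w i * ∫ x, g (x + z i) ∂(halfGaussian E) := mul_le_mul_of_nonneg_right (hw i) (hn i)
    _ ≤ _ := Finset.single_le_sum (f := fun j => w j * ∫ x, g (x + z j) ∂(halfGaussian E))
      (fun j _ => mul_nonneg (hκ.le.trans (hw j)) (hn j)) (Finset.mem_univ i)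

/-- The discrete counterpart of `entropy_le_integral_sq_div`, for the entropy between components. -/
theorem sum_mul_log_sub_le {w h : ι → ℝ} {c : ℝ} (hw : ∀ i, 0 ≤ w i) (hw1 : ∑ i, w i = 1)
    (hh : ∀ i, 0 < h i) (hc : 0 < c) :
    ∑ i, w i * (h i * Real.log (h i)) - (∑ i, w i * h i) * Real.log (∑ i, w i * h i)
      ≤ ∑ i, w i * ((h i - c) ^ 2 / c) := by
  have hm : 0 < ∑ i, w i * h i := by
    have h0 (i : ι) : 0 ≤ w i * h i := mul_nonneg (hw i) (hh i).le
    refine (Finset.sum_nonneg fun i _ => h0 i).lt_of_ne fun hz => ?_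
    have hz2 := (Finset.sum_eq_zero_iff_of_nonneg fun i _ => h0 i).1 hz.symm
    have : ∑ i, w i = 0 := Finset.sum_eq_zero fun i hi =>
      (mul_eq_zero.1 (hz2 i hi)).resolve_right (hh i).ne'
    linarith
  have h1 : ∑ i, w i * (h i * Real.log (h i))
      ≤ ∑ i, (w i * ((h i - c) ^ 2 / c) + (w i * h i * (1 + Real.log c) - w i * c)) := by
    refine Finset.sum_le_sum fun i _ => ?_
    have := mul_le_mul_of_nonneg_left (mul_log_sub_le_sq_div (hh i) hc) (hw i)
    linarith
  rw [Finset.sum_add_distrib, Finset.sum_sub_distrib, ← Finset.sum_mul, ← Finset.sum_mul, hw1] at h1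
  have h2 := sub_mul_log_le hm hc
  linarith

theorem sq_sub_div_le {s c : ℝ} (hs : 0 < s) (hsc : s ≤ c) :
    (s - c) ^ 2 / c ≤ 4 * (√s - √c) ^ 2 := by
  have hc := hs.trans_le hsc
  rw [div_le_iff₀ hc]
  have e1 := Real.sq_sqrt hs.le
  have e2 := Real.sq_sqrt hc.le
  have l := Real.sqrt_le_sqrt hsc
  have p := Real.sqrt_nonneg s
  calc (s - c) ^ 2 = (√s - √c) ^ 2 * (√s + √c) ^ 2 := by
        rw [← mul_pow]
        congr 1
        linear_combination e2 - e1
    _ ≤ (√s - √c) ^ 2 * (2 * √c) ^ 2 := by gcongr; linarith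
    _ = _ := by rw [mul_pow, e2]; ring

/-- The logarithmic Sobolev inequality for Gaussian mixtures with weights bounded below. -/
theorem IsGaussianMixture.lsi {Q : Measure E} {w : ι → ℝ} {z : ι → E}
    (hQ : IsGaussianMixture Q w z) {κ R : ℝ} (hκ : 0 < κ) (hw : ∀ i, κ ≤ w i)
    (hR : ∀ i j, ‖z i - z j‖ ≤ R) {ε M L K : ℝ} (hε : 0 < ε) {f a : E → ℝ}
    (h : SlopeBound f a ε M L K) :
    entropy Q f ≤ (2 * (∫ x, ‖x‖ ^ 2 ∂(halfGaussian E)) + 8 * R ^ 2 * Real.exp (R ^ 2 / 4) * κ⁻¹)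
      * ∫ x, a x ^ 2 / f x ∂Q := by
  have hw0 (i : ι) : 0 ≤ w i := hκ.le.trans (hw i)
  set m2 := ∫ x, ‖x‖ ^ 2 ∂(halfGaussian E)
  set I := ∫ x, a x ^ 2 / f x ∂Q with hI
  have hI0 : 0 ≤ I := integral_nonneg fun x => h.sq_div_nonneg hε x
  have hne : Nonempty ι := by
    by_contra hn
    rw [not_nonempty_iff] at hn
    simpa using hQ.sum_eq_one
  let F : E → ℝ := fun y => ∫ x, f (y + x) ∂(halfGaussian E)
  have hF : SlopeBound F (fun y => ∫ x, a (y + x) ∂(halfGaussian E)) ε M L K := h.average _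
  have hFi (i : ι) : ∫ x, f (x + z i) ∂(halfGaussian E) = F (z i) := by simp only [F, add_comm]
  have hFp (y : E) : 0 < F y := hε.trans_le (hF.lower y)
  have hlogc : Continuous (fun x => f x * Real.log (f x)) :=
    h.continuous.mul (h.continuous.log fun x => (hε.trans_le (h.lower x)).ne')
  have e1 : entropy Q f = ∑ i, w i * entropy (halfGaussian E) (fun x => f (x + z i))
      + (∑ i, w i * (F (z i) * Real.log (F (z i)))
        - (∑ i, w i * F (z i)) * Real.log (∑ i, w i * F (z i))) := by
    obtain ⟨b, hb⟩ : ∃ b : ℝ, ∀ x, |f x * Real.log (f x)| ≤ b := by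
      have hc : ContinuousOn (fun s : ℝ => |s * Real.log s|) (Set.Icc ε M) :=
        Real.continuous_mul_log.abs.continuousOn
      obtain ⟨b, hb⟩ := (isCompact_Icc.image_of_continuousOn hc).bddAbove
      exact ⟨b, fun x => hb ⟨f x, ⟨h.lower x, h.upper x⟩, rfl⟩⟩
    unfold entropy
    rw [hQ.integral_eq f ε M h.continuous h.lower h.upper, hQ.integral_eq _ (-b) b hlogc
      (fun x => (abs_le.1 (hb x)).1) (fun x => (abs_le.1 (hb x)).2)]
    simp only [hFi, mul_sub, Finset.sum_sub_distrib]
    ring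
  have e2 : ∑ i, w i * entropy (halfGaussian E) (fun x => f (x + z i)) ≤ 2 * m2 * I := by
    -- Within each component the Gaussian inequality applies to a translate of `f`; the weighted
    -- Fisher informations add up to that of `Q`.
    rw [hI, hQ.integral_eq _ 0 (L ^ 2 / ε) (h.continuous_sq_div hε) (h.sq_div_nonneg hε)
      (h.sq_div_le hε), Finset.mul_sum]
    refine Finset.sum_le_sum fun i _ => ?_
    have := mul_le_mul_of_nonneg_left (lsi_halfGaussian hε (h.comp_add_right (z i))) (hw0 i)
    linarith
  -- Bound for the squared slope of `√F` along a segment: each of the two end Gaussians has Fisher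
  -- information at most `κ⁻¹ I`.
  set B2 := Real.exp (R ^ 2 / 4) * (2 * κ⁻¹ * I) with hB2
  have hB20 : 0 ≤ B2 := by positivity
  have key (i j : ι) : (√(F (z i)) - √(F (z j))) ^ 2 ≤ R ^ 2 * B2 := by
    have hv : z j + (z i - z j) = z i := by abel
    have hn : ‖z i - z j‖ ^ 2 ≤ R ^ 2 := pow_le_pow_left₀ (norm_nonneg _) (hR i j) 2
    have := hF.abs_sqrt_sub_sqrt_le (B := √B2) hε (z j) (z i - z j) ?_
    · rw [hv] at this
      rw [← sq_abs]
      calc _ ≤ (‖z i - z j‖ * √B2) ^ 2 := pow_le_pow_left₀ (abs_nonneg _) this 2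
        _ = ‖z i - z j‖ ^ 2 * B2 := by rw [mul_pow, Real.sq_sqrt hB20]
        _ ≤ _ := by gcongr
    · intro t ht0 ht1
      set y := z j + t • (z i - z j) with hy
      have h1 := h.average_sq_div_le hε (halfGaussian E) y
      have h2 := integral_add_segment_le (h.continuous_sq_div hε) (h.sq_div_nonneg hε)
        (h.sq_div_le hε) (z j) (z i - z j) ht0 ht1
      rw [← hy, hv] at h2
      have h3 := hQ.integral_add_le hκ hw (h.continuous_sq_div hε) (h.sq_div_nonneg hε)
        (h.sq_div_le hε)
      have h4 : (∫ x, a (y + x) ∂(halfGaussian E)) ^ 2 / F y ≤ B2 := by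
        simp only [add_comm y] at h1 ⊢
        simp only [F, add_comm y]
        calc _ ≤ _ := h1.trans h2
          _ ≤ Real.exp (‖z i - z j‖ ^ 2 / 4) * (κ⁻¹ * I + κ⁻¹ * I) := by
            gcongr
            · exact h3 j
            · exact h3 i
          _ ≤ Real.exp (R ^ 2 / 4) * (κ⁻¹ * I + κ⁻¹ * I) := by gcongr
          _ = _ := by rw [hB2]; ring
      rw [div_le_iff₀ (hFp y)] at h4
      rw [← Real.sqrt_mul hB20]
      exact Real.le_sqrt_of_sq_le h4
  -- The largest component mean is the reference value `c`, since `sq_sub_div_le` requires `s ≤ c`.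
  obtain ⟨k, hk⟩ := Finite.exists_max fun i => F (z i)
  have e3 : ∑ i, w i * (F (z i) * Real.log (F (z i)))
        - (∑ i, w i * F (z i)) * Real.log (∑ i, w i * F (z i)) ≤ 4 * (R ^ 2 * B2) := by
    refine (sum_mul_log_sub_le hw0 hQ.sum_eq_one (fun i => hFp (z i)) (hFp (z k))).trans ?_
    calc _ ≤ ∑ i, w i * (4 * (R ^ 2 * B2)) := by
          refine Finset.sum_le_sum fun i _ => mul_le_mul_of_nonneg_left ?_ (hw0 i)
          exact (sq_sub_div_le (hFp (z i)) (hk i)).trans (by gcongr; exact key i k)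
      _ = _ := by rw [← Finset.sum_mul, hQ.sum_eq_one, one_mul]
  rw [e1]
  calc _ ≤ 2 * m2 * I + 4 * (R ^ 2 * B2) := add_le_add e2 e3
    _ = _ := by rw [hB2]; ring

/-- Compact support makes `u` and its derivative Lipschitz; the shift by `ε` supplies the lower
bound. The remainder in `approx` comes from the mean value inequality on a ball. -/
theorem slopeBound_of_contDiff {u : E → ℝ} (hu : ContDiff ℝ ∞ u) (hc : HasCompactSupport u)
    (h0 : ∀ x, 0 ≤ u x) (ε : ℝ) :
    ∃ M L K, SlopeBound (fun x => u x + ε) (fun x => ‖fderiv ℝ u x‖) ε M L K := by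
  obtain ⟨M, hM⟩ := (hc.isCompact_range hu.continuous).bddAbove
  obtain ⟨L, hL⟩ := hu.lipschitzWith_of_hasCompactSupport hc (by simp)
  have hu' : ContDiff ℝ ∞ (fderiv ℝ u) := hu.fderiv_right (by simp)
  obtain ⟨K, hK⟩ := hu'.lipschitzWith_of_hasCompactSupport (hc.fderiv ℝ) (by simp)
  refine ⟨M + ε, L, K, ⟨fun x => by linarith [h0 x], fun x => by linarith [hM ⟨x, rfl⟩],
    fun x => norm_nonneg _, fun x => norm_fderiv_le_of_lipschitz ℝ hL, fun x k => ?_, fun x k => ?_,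
    fun x k => ?_⟩⟩
  · have := hL.dist_le_mul (x + k) x
    rwa [Real.dist_eq, dist_eq_norm, add_sub_cancel_left, ← add_sub_add_right_eq_sub _ _ ε] at this
  · have := hK.dist_le_mul (x + k) x
    rw [dist_eq_norm, dist_eq_norm, add_sub_cancel_left] at this
    exact (abs_norm_sub_norm_le _ _).trans this
  · have hd (y : E) : HasFDerivAt u (fderiv ℝ u y) y :=
      ((hu.differentiable (by simp)) y).hasFDerivAt
    have h1 := (convex_closedBall x ‖k‖).norm_image_sub_le_of_norm_hasFDerivWithin_le'
      (f := u) (f' := fderiv ℝ u) (φ := fderiv ℝ u x) (C := K * ‖k‖)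
      (fun y _ => (hd y).hasFDerivWithinAt) (fun y hy => ?_)
      (Metric.mem_closedBall_self (norm_nonneg k)) (y := x + k) (by simp)
    · rw [add_sub_cancel_left, Real.norm_eq_abs] at h1
      have h2 := (fderiv ℝ u x).le_opNorm k
      rw [Real.norm_eq_abs] at h2
      rw [add_sub_add_right_eq_sub]
      calc |u (x + k) - u x| = |(u (x + k) - u x - fderiv ℝ u x k) + fderiv ℝ u x k| := by
            rw [sub_add_cancel]
        _ ≤ K * ‖k‖ * ‖k‖ + ‖fderiv ℝ u x‖ * ‖k‖ := (abs_add_le _ _).trans (add_le_add h1 h2)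
        _ = _ := by ring
    · have := hK.dist_le_mul y x
      rw [dist_eq_norm] at this
      exact this.trans (by gcongr; exact hy)

end Mixture

/-! ### Mollification in `L¹` and of weak gradients. -/

section Mollify

open Filter Topology ContinuousLinearMap
open scoped Convolution

variable {d : ℕ} {F : Type*} [NormedAddCommGroup F] [NormedSpace ℝ F] [CompleteSpace F]

/-- Bump functions centred at the origin with radii tending to zero. -/
noncomputable def mollifier (d n : ℕ) : ContDiffBump (0 : Eucl d) where
  rIn := 1 / (2 * ((n : ℝ) + 1))
  rOut := 1 / ((n : ℝ) + 1)
  rIn_pos := by positivity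
  rIn_lt_rOut := by
    apply one_div_lt_one_div_of_lt (by positivity)
    have : (0 : ℝ) ≤ n := n.cast_nonneg
    linarith

/-- Convolution with a normalized mollifier. -/
noncomputable def mollify (n : ℕ) (f : Eucl d → F) : Eucl d → F :=
  (mollifier d n).normed volume ⋆[lsmul ℝ ℝ, volume] f

theorem mollify_apply (n : ℕ) (f : Eucl d → F) (x : Eucl d) :
    mollify n f x = ∫ t, (mollifier d n).normed volume t • f (x - t) := rfl

theorem tendsto_mollifier_rOut (d : ℕ) :
    Tendsto (fun n => (mollifier d n).rOut) atTop (𝓝 0) :=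
  tendsto_one_div_add_atTop_nhds_zero_nat

theorem mollifier_rOut_le_one (d n : ℕ) : (mollifier d n).rOut ≤ 1 := by
  change 1 / ((n : ℝ) + 1) ≤ 1
  rw [div_le_one (by positivity)]
  have : (0 : ℝ) ≤ n := n.cast_nonneg
  linarith

theorem ae_tendsto_mollify {f : Eucl d → F} (hf : LocallyIntegrable f) :
    ∀ᵐ x, Tendsto (fun n => mollify n f x) atTop (𝓝 (f x)) := by
  refine ContDiffBump.ae_convolution_tendsto_right_of_locallyIntegrable (K := 2)
    (tendsto_mollifier_rOut d) (Eventually.of_forall fun n => le_of_eq ?_) hf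
  change 1 / ((n : ℝ) + 1) = 2 * (1 / (2 * ((n : ℝ) + 1)))
  field_simp

theorem contDiff_mollify (n : ℕ) {f : Eucl d → F} (hf : LocallyIntegrable f) :
    ContDiff ℝ ∞ (mollify n f) :=
  (ContDiffBump.hasCompactSupport_normed _).contDiff_convolution_left _
    (ContDiffBump.contDiff_normed _) hf

theorem hasCompactSupport_mollify (n : ℕ) {f : Eucl d → F} (hf : HasCompactSupport f) :
    HasCompactSupport (mollify n f) :=
  (ContDiffBump.hasCompactSupport_normed _).convolution _ hf

theorem integrable_mollify_integrand (n : ℕ) {f : Eucl d → F} (hf : LocallyIntegrable f)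
    (x : Eucl d) : Integrable (fun t => (mollifier d n).normed volume t • f (x - t)) :=
  (ContDiffBump.hasCompactSupport_normed _).convolutionExists_left (lsmul ℝ ℝ)
    (ContDiffBump.continuous_normed _) hf x

theorem integrable_mollify (n : ℕ) {f : Eucl d → F} (hf : Integrable f) :
    Integrable (mollify n f) :=
  (ContDiffBump.integrable_normed _).integrable_convolution _ hf

theorem integral_mollify (n : ℕ) {f : Eucl d → F} (hf : Integrable f) :
    ∫ x, mollify n f x = ∫ x, f x := by
  have := integral_convolution (lsmul ℝ ℝ)
    ((mollifier d n).integrable_normed (μ := volume)) hf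
  rw [ContDiffBump.integral_normed] at this
  simpa [mollify] using this

theorem norm_mollify_le (n : ℕ) {f : Eucl d → F} (x : Eucl d) :
    ‖mollify n f x‖ ≤ mollify n (fun y => ‖f y‖) x := by
  rw [mollify_apply, mollify_apply]
  refine (norm_integral_le_integral_norm _).trans_eq (integral_congr_ae (ae_of_all _ fun t => ?_))
  simp only [norm_smul, Real.norm_of_nonneg (ContDiffBump.nonneg_normed _ t), smul_eq_mul]

theorem mollify_nonneg (n : ℕ) {f : Eucl d → ℝ} (h0 : ∀ x, 0 ≤ f x) (x : Eucl d) :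
    0 ≤ mollify n f x :=
  integral_nonneg fun t => mul_nonneg (ContDiffBump.nonneg_normed _ t) (h0 _)

/-- Almost everywhere convergence plus conservation of mass. With `A` the mollification of `‖f‖`,
the integrand is at most `min ‖mollify n f - f‖ (2 ‖f‖) + (‖f‖ - A)⁺ + (A - ‖f‖)`: the first two
terms are dominated and tend to zero, the last has integral zero. -/
theorem tendsto_integral_norm_mollify_sub {f : Eucl d → F} (hf : Integrable f) :
    Tendsto (fun n => ∫ x, ‖mollify n f x - f x‖) atTop (𝓝 0) := by
  have hA (n : ℕ) : Integrable (mollify n fun y => ‖f y‖) := integrable_mollify n hf.norm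
  have hG (n : ℕ) : Integrable (mollify n f) := integrable_mollify n hf
  have i1 (n : ℕ) : Integrable (fun x => min ‖mollify n f x - f x‖ (2 * ‖f x‖)) :=
    ((hG n).sub hf).norm.inf (hf.norm.const_mul 2)
  have i2 (n : ℕ) : Integrable (fun x => max (‖f x‖ - mollify n (fun y => ‖f y‖) x) 0) :=
    (hf.norm.sub (hA n)).pos_part
  have l1 : Tendsto (fun n => ∫ x, min ‖mollify n f x - f x‖ (2 * ‖f x‖)) atTop (𝓝 0) := by
    have := tendsto_integral_of_dominated_convergence (μ := volume)
      (F := fun n x => min ‖mollify n f x - f x‖ (2 * ‖f x‖)) (f := fun _ => (0 : ℝ))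
      (fun x => 2 * ‖f x‖) (fun n => (i1 n).1) (hf.norm.const_mul 2)
      (fun n => ae_of_all _ fun x => ?_) ?_
    · simpa using this
    · rw [Real.norm_of_nonneg (le_min (norm_nonneg _) (by positivity))]
      exact min_le_right _ _
    · filter_upwards [ae_tendsto_mollify hf.locallyIntegrable] with x hx
      have h1 : Tendsto (fun n => ‖mollify n f x - f x‖) atTop (𝓝 0) :=
        tendsto_iff_norm_sub_tendsto_zero.1 hx
      have := h1.min (tendsto_const_nhds (x := 2 * ‖f x‖))
      rwa [min_eq_left (by positivity)] at this
  have l2 : Tendsto (fun n => ∫ x, max (‖f x‖ - mollify n (fun y => ‖f y‖) x) 0) atTop (𝓝 0) := by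
    have := tendsto_integral_of_dominated_convergence (μ := volume)
      (F := fun n x => max (‖f x‖ - mollify n (fun y => ‖f y‖) x) 0) (f := fun _ => (0 : ℝ))
      (fun x => ‖f x‖) (fun n => (i2 n).1) hf.norm
      (fun n => ae_of_all _ fun x => ?_) ?_
    · simpa using this
    · rw [Real.norm_of_nonneg (le_max_right _ _)]
      refine max_le ?_ (norm_nonneg _)
      linarith [mollify_nonneg n (fun y => norm_nonneg (f y)) x]
    · filter_upwards [ae_tendsto_mollify hf.norm.locallyIntegrable] with x hx
      have := ((tendsto_const_nhds (x := ‖f x‖)).sub hx).max (tendsto_const_nhds (x := (0 : ℝ)))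
      simpa using this
  have l3 := l1.add l2
  rw [add_zero] at l3
  refine squeeze_zero (fun n => integral_nonneg fun x => norm_nonneg _) (fun n => ?_) l3
  have i3 : Integrable (fun x => mollify n (fun y => ‖f y‖) x - ‖f x‖) := (hA n).sub hf.norm
  have e : ∫ x, (mollify n (fun y => ‖f y‖) x - ‖f x‖) = 0 := by
    rw [integral_sub (hA n) hf.norm, integral_mollify n hf.norm, sub_self]
  refine le_of_le_of_eq ?_ ((congrArg _ e).trans (add_zero _))
  have i12 : Integrable (fun x => min ‖mollify n f x - f x‖ (2 * ‖f x‖)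
      + max (‖f x‖ - mollify n (fun y => ‖f y‖) x) 0) := (i1 n).add (i2 n)
  rw [← integral_add (i1 n) (i2 n), ← integral_add i12 i3]
  refine integral_mono ((hG n).sub hf).norm (i12.add i3) fun x => ?_
  have h1 : ‖mollify n f x - f x‖ ≤ mollify n (fun y => ‖f y‖) x + ‖f x‖ :=
    (norm_sub_le _ _).trans (add_le_add (norm_mollify_le n x) le_rfl)
  change _ ≤ min ‖mollify n f x - f x‖ (2 * ‖f x‖)
    + max (‖f x‖ - mollify n (fun y => ‖f y‖) x) 0 + (mollify n (fun y => ‖f y‖) x - ‖f x‖)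
  have h2 := le_max_left (‖f x‖ - mollify n (fun y => ‖f y‖) x) 0
  have h3 := le_max_right (‖f x‖ - mollify n (fun y => ‖f y‖) x) 0
  rcases min_cases ‖mollify n f x - f x‖ (2 * ‖f x‖) with h | h <;> linarith

/-- The derivative falls on the kernel, and the weak gradient identity is tested against `y ↦ ρ (x -
y)`. -/
theorem HasWeakGradient.hasGradientAt_mollify {f : Eucl d → ℝ} {g : Eucl d → Eucl d}
    (h : HasWeakGradient f g) (n : ℕ) (x : Eucl d) :
    HasGradientAt (mollify n f) (mollify n g x) x := by
  obtain ⟨hf, hg, hw⟩ := h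
  set ρ : Eucl d → ℝ := (mollifier d n).normed volume with hρ
  have hρs : ContDiff ℝ ∞ ρ := ContDiffBump.contDiff_normed _
  have hρc : HasCompactSupport ρ := ContDiffBump.hasCompactSupport_normed _
  have hd := hρc.hasFDerivAt_convolution_left (lsmul ℝ ℝ) (μ := volume)
    (hρs.of_le (by simp)) hf x
  set φ : Eucl d → ℝ := fun y => ρ (x - y) with hφ
  have hφs : ContDiff ℝ ∞ φ := hρs.comp (contDiff_const.sub contDiff_id)
  have hφc : HasCompactSupport φ := hρc.comp_homeomorph (Homeomorph.subLeft x)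
  have hφd (y : Eucl d) : fderiv ℝ φ y = -fderiv ℝ ρ (x - y) := by
    have h1 : HasFDerivAt ρ (fderiv ℝ ρ (x - y)) (x - y) :=
      (hρs.differentiable (by simp) _).hasFDerivAt
    have h2 := h1.comp y ((hasFDerivAt_id y).const_sub x)
    rw [show φ = ρ ∘ fun y => x - y from rfl, h2.fderiv]
    ext v
    simp
  have e1 : mollify n g x = ∫ y, φ y • g y := convolution_lsmul_swap
  have e2 := hw φ hφs hφc
  suffices heq : InnerProductSpace.toDual ℝ _ (mollify n g x)
      = (fderiv ℝ ρ ⋆[precompL (Eucl d) (lsmul ℝ ℝ), volume] f) x by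
    rw [hasGradientAt_iff_hasFDerivAt, heq]
    exact hd
  rw [e1, ← neg_neg (∫ y, φ y • g y), ← e2, map_neg, convolution_eq_swap]
  rw [← LinearIsometryEquiv.coe_toContinuousLinearEquiv,
    ← ContinuousLinearEquiv.integral_comp_comm, ← integral_neg]
  congr 1
  ext y v
  simp [hφd, mul_comm]

end Mollify

/-! ### Vanishing of the weak gradient on the zero set. -/

section WeakGradientZero

open Filter Topology

variable {d : ℕ} {f : Eucl d → ℝ} {g : Eucl d → Eucl d}

theorem sq_div_add_sq_mem {ε t : ℝ} (hε : 0 < ε) (ht : 0 ≤ t) :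
    0 ≤ ε ^ 2 / (ε + t) ^ 2 ∧ ε ^ 2 / (ε + t) ^ 2 ≤ 1 := by
  refine ⟨by positivity, ?_⟩
  rw [div_le_one (by positivity)]
  exact pow_le_pow_left₀ hε.le (by linarith) 2

/-- The weight is the derivative of `t ↦ ε t / (ε + t)`, which takes values in `[0, ε]` on `t ≥ 0`.
Integration by parts then gives a bound of order `ε`, while the weight tends to the indicator of `t
= 0` as `ε → 0`. -/
theorem HasWeakGradient.abs_integral_mollify_le (h : HasWeakGradient f g) (h0 : ∀ x, 0 ≤ f x)
    {φ : Eucl d → ℝ} (hφ : ContDiff ℝ ∞ φ) (hc : HasCompactSupport φ) (v : Eucl d) {ε : ℝ}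
    (hε : 0 < ε) (n : ℕ) :
    |∫ x, φ x * (ε ^ 2 / (ε + mollify n f x) ^ 2 * inner ℝ (mollify n g x) v)|
      ≤ ε * ∫ x, |fderiv ℝ φ x v| := by
  set F := mollify n f with hF
  have F0 (x : Eucl d) : 0 ≤ F x := mollify_nonneg n h0 x
  have Fne (x : Eucl d) : ε + F x ≠ 0 := by linarith [F0 x]
  have Fs : ContDiff ℝ ∞ F := contDiff_mollify n h.1
  set H : Eucl d → ℝ := fun x => ε * F x / (ε + F x) with hH
  have Hs : ContDiff ℝ ∞ H := (contDiff_const.mul Fs).div (contDiff_const.add Fs) Fne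
  have Hd (x : Eucl d) :
      fderiv ℝ H x v = ε ^ 2 / (ε + F x) ^ 2 * inner ℝ (mollify n g x) v := by
    have hg := h.hasGradientAt_mollify n x
    have hβ : HasDerivAt (fun t : ℝ => ε * t / (ε + t)) (ε ^ 2 / (ε + F x) ^ 2) (F x) := by
      have : HasDerivAt (fun t : ℝ => ε * t / (ε + t))
          ((ε * 1 * (ε + F x) - ε * F x * 1) / (ε + F x) ^ 2) (F x) :=
        ((hasDerivAt_id (F x)).const_mul ε).div ((hasDerivAt_id (F x)).const_add ε) (Fne x)
      rwa [show ε * 1 * (ε + F x) - ε * F x * 1 = ε ^ 2 by ring] at this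
    have := hβ.comp_hasFDerivAt x hg.hasFDerivAt
    rw [show H = (fun t : ℝ => ε * t / (ε + t)) ∘ F from rfl, this.fderiv]
    simp
  have φd : Continuous fun x => fderiv ℝ φ x v :=
    (hφ.continuous_fderiv (by simp)).clm_apply continuous_const
  have φdc : HasCompactSupport fun x => fderiv ℝ φ x v := hc.fderiv_apply ℝ v
  have Hdc : Continuous fun x => fderiv ℝ H x v :=
    (Hs.continuous_fderiv (by simp)).clm_apply continuous_const
  have key := integral_mul_fderiv_eq_neg_fderiv_mul_of_integrable (μ := volume) (f := φ) (g := H)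
    (v := v) ((φd.mul Hs.continuous).integrable_of_hasCompactSupport φdc.mul_right)
    ((hφ.continuous.mul Hdc).integrable_of_hasCompactSupport hc.mul_right)
    ((hφ.continuous.mul Hs.continuous).integrable_of_hasCompactSupport hc.mul_right)
    (fun x _ => hφ.differentiable (by simp) x) (fun x _ => Hs.differentiable (by simp) x)
  simp_rw [← Hd]
  rw [key, abs_neg, ← integral_const_mul]
  refine abs_integral_le_integral_abs.trans (integral_mono
    ((φd.mul Hs.continuous).integrable_of_hasCompactSupport φdc.mul_right).abs
    ((φd.abs.integrable_of_hasCompactSupport φdc.abs).const_mul ε) fun x => ?_)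
  have p : 0 < ε + F x := by linarith [F0 x]
  have h1 : |H x| ≤ ε := by
    rw [hH, abs_of_nonneg (div_nonneg (mul_nonneg hε.le (F0 x)) p.le), div_le_iff₀ p]
    nlinarith
  simp only [abs_mul]
  rw [mul_comm]
  exact mul_le_mul_of_nonneg_right h1 (abs_nonneg _)

theorem HasWeakGradient.abs_integral_le (h : HasWeakGradient f g) (hf : Integrable f)
    (hg : Integrable g) (h0 : ∀ x, 0 ≤ f x)
    {φ : Eucl d → ℝ} (hφ : ContDiff ℝ ∞ φ) (hc : HasCompactSupport φ) (v : Eucl d) {ε : ℝ}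
    (hε : 0 < ε) :
    |∫ x, φ x * (ε ^ 2 / (ε + f x) ^ 2 * inner ℝ (g x) v)| ≤ ε * ∫ x, |fderiv ℝ φ x v| := by
  obtain ⟨B, hB⟩ := hφ.continuous.bounded_above_of_compact_support hc
  have hB0 : 0 ≤ B := (norm_nonneg _).trans (hB 0)
  let w (u : ℝ) : ℝ := ε ^ 2 / (ε + u) ^ 2
  have wm (u : Eucl d → ℝ) (hu : AEStronglyMeasurable u) :
      AEStronglyMeasurable (fun x => w (u x)) := by
    have hw : Measurable w := measurable_const.div ((measurable_const.add measurable_id).pow_const 2)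
    exact (hw.comp_aemeasurable hu.aemeasurable).aestronglyMeasurable
  have wb (u : ℝ) (hu : 0 ≤ u) : ‖w u‖ ≤ 1 := by
    obtain ⟨h1, h2⟩ := sq_div_add_sq_mem hε hu
    rwa [Real.norm_of_nonneg h1]
  have bound (u : ℝ) (hu : 0 ≤ u) (x y : Eucl d) :
      ‖φ x * (w u * inner ℝ y v)‖ ≤ B * ‖v‖ * ‖y‖ := by
    rw [norm_mul, norm_mul]
    calc _ ≤ B * (1 * (‖y‖ * ‖v‖)) := by
          gcongr
          · exact hB x
          · exact wb u hu
          · exact norm_inner_le_norm y v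
      _ = _ := by ring
  have F0 (n : ℕ) (x : Eucl d) : 0 ≤ mollify n f x := mollify_nonneg n h0 x
  have meas (u : Eucl d → ℝ) (k : Eucl d → Eucl d) (hu : AEStronglyMeasurable u)
      (hk : AEStronglyMeasurable k) :
      AEStronglyMeasurable (fun x => φ x * (w (u x) * inner ℝ (k x) v)) :=
    hφ.continuous.aestronglyMeasurable.mul
      ((wm u hu).mul (hk.inner aestronglyMeasurable_const))
  have int (u : Eucl d → ℝ) (k : Eucl d → Eucl d) (hu : AEStronglyMeasurable u)
      (hu0 : ∀ x, 0 ≤ u x) (hk : Integrable k) :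
      Integrable (fun x => φ x * (w (u x) * inner ℝ (k x) v)) :=
    (hk.norm.const_mul (B * ‖v‖)).mono' (meas u k hu hk.1)
      (ae_of_all _ fun x => bound _ (hu0 x) x (k x))
  have hFm (n : ℕ) : AEStronglyMeasurable (mollify n f) := (integrable_mollify n hf).1
  have hGi (n : ℕ) : Integrable (mollify n g) := integrable_mollify n hg
  -- The limit is split: `mollify n g` is replaced by `g` through `L¹` convergence, then the bounded
  -- weight converges under domination by `g`.
  have l1 : Tendsto (fun n => ∫ x, φ x * (w (mollify n f x) * inner ℝ (mollify n g x - g x) v))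
      atTop (𝓝 0) := by
    have hz := (tendsto_integral_norm_mollify_sub hg).const_mul (B * ‖v‖)
    rw [mul_zero] at hz
    refine squeeze_zero_norm (fun n => ?_) hz
    rw [← integral_const_mul]
    exact norm_integral_le_of_norm_le (((hGi n).sub hg).norm.const_mul _)
      (ae_of_all _ fun x => bound _ (F0 n x) x _)
  have l2 : Tendsto (fun n => ∫ x, φ x * (w (mollify n f x) * inner ℝ (g x) v))
      atTop (𝓝 (∫ x, φ x * (w (f x) * inner ℝ (g x) v))) := by
    refine tendsto_integral_of_dominated_convergence (fun x => B * ‖v‖ * ‖g x‖)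
      (fun n => meas _ _ (hFm n) hg.1) (hg.norm.const_mul _)
      (fun n => ae_of_all _ fun x => bound _ (F0 n x) x _) ?_
    filter_upwards [ae_tendsto_mollify hf.locallyIntegrable] with x hx
    have hne : (ε + f x) ^ 2 ≠ 0 := by
      have := h0 x
      positivity
    exact ((tendsto_const_nhds.div ((hx.const_add ε).pow 2) hne).mul_const _).const_mul _
  have l3 := (l1.add l2).abs
  rw [zero_add] at l3
  refine le_of_tendsto l3 (Eventually.of_forall fun n => ?_)
  have hi : Integrable (fun x => φ x * (w (mollify n f x) * inner ℝ (mollify n g x - g x) v)) :=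
    int _ _ (hFm n) (F0 n) ((hGi n).sub hg)
  rw [← integral_add hi (int _ _ (hFm n) (F0 n) hg)]
  refine le_of_eq_of_le ?_ (h.abs_integral_mollify_le h0 hφ hc v hε n)
  congr 2
  ext x
  simp only [w, inner_sub_left]
  ring

/-- The weak gradient of a nonnegative function vanishes almost everywhere on its zero set. -/
theorem HasWeakGradient.ae_eq_zero_of_eq_zero (h : HasWeakGradient f g) (hf : Integrable f)
    (hg : Integrable g) (h0 : ∀ x, 0 ≤ f x) : ∀ᵐ x, f x = 0 → g x = 0 := by
  classical
  have key (φ : Eucl d → ℝ) (hφ : ContDiff ℝ ∞ φ) (hc : HasCompactSupport φ) (v : Eucl d) :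
      ∫ x, φ x * ((if f x = 0 then 1 else 0) * inner ℝ (g x) v) = 0 := by
    obtain ⟨B, hB⟩ := hφ.continuous.bounded_above_of_compact_support hc
    have hB0 : 0 ≤ B := (norm_nonneg _).trans (hB 0)
    set ε : ℕ → ℝ := fun n => 1 / ((n : ℝ) + 1) with hε
    have εpos (n : ℕ) : 0 < ε n := by positivity
    have εlim : Tendsto ε atTop (𝓝 0) := tendsto_one_div_add_atTop_nhds_zero_nat
    have l1 : Tendsto (fun n => ∫ x, φ x * (ε n ^ 2 / (ε n + f x) ^ 2 * inner ℝ (g x) v))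
        atTop (𝓝 (∫ x, φ x * ((if f x = 0 then 1 else 0) * inner ℝ (g x) v))) := by
      refine tendsto_integral_of_dominated_convergence (fun x => B * ‖v‖ * ‖g x‖)
        (fun n => ?_) (hg.norm.const_mul _) (fun n => ae_of_all _ fun x => ?_)
        (ae_of_all _ fun x => ?_)
      · exact hφ.continuous.aestronglyMeasurable.mul
          ((show Measurable fun t : ℝ => ε n ^ 2 / (ε n + t) ^ 2 from measurable_const.div
            ((measurable_const.add measurable_id).pow_const 2)).comp_aemeasurable
            hf.1.aemeasurable |>.aestronglyMeasurable.mul (hg.1.inner aestronglyMeasurable_const))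
      · obtain ⟨h1, h2⟩ := sq_div_add_sq_mem (εpos n) (h0 x)
        rw [norm_mul, norm_mul, Real.norm_of_nonneg h1]
        calc _ ≤ B * (1 * (‖g x‖ * ‖v‖)) := by
              gcongr
              · exact hB x
              · exact norm_inner_le_norm (g x) v
          _ = _ := by ring
      · refine Tendsto.const_mul _ (Tendsto.mul_const _ ?_)
        by_cases hx : f x = 0
        · simp only [hx, if_true, add_zero]
          refine tendsto_const_nhds.congr fun n => ?_
          rw [div_self (pow_ne_zero 2 (εpos n).ne')]
        · simp only [hx, if_false]
          have := ((εlim.pow 2).div ((εlim.add_const (f x)).pow 2) (by simpa using hx))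
          rw [zero_pow two_ne_zero, zero_div] at this
          exact this
    have l2 : Tendsto (fun n => ε n * ∫ x, |fderiv ℝ φ x v|) atTop (𝓝 0) := by
      simpa using εlim.mul_const (∫ x, |fderiv ℝ φ x v|)
    exact tendsto_nhds_unique l1 (squeeze_zero_norm
      (fun n => h.abs_integral_le hf hg h0 hφ hc v (εpos n)) l2)
  obtain ⟨f', hf'm, hf'⟩ := hf.1
  have hs : MeasurableSet {x | f' x = 0} := hf'm.measurable (measurableSet_singleton 0)
  have hae : ∀ᵐ x, (if f x = 0 then g x else 0) = 0 := by
    have hi : Integrable fun x => if f x = 0 then g x else 0 := by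
      refine (hg.indicator hs).congr ?_
      filter_upwards [hf'] with x hx
      simp only [Set.indicator, Set.mem_ofPred_eq, hx]
    refine ae_eq_zero_of_integral_contDiff_smul_eq_zero hi.locallyIntegrable fun φ hφ hc => ?_
    have hi2 : Integrable fun x => φ x • if f x = 0 then g x else 0 :=
      hi.locallyIntegrable.integrable_smul_left_of_hasCompactSupport hφ.continuous hc
    refine ext_inner_right ℝ fun v => ?_
    rw [inner_zero_left, real_inner_comm, ← integral_inner hi2]
    refine Eq.trans ?_ (key φ hφ hc v)
    congr 1
    ext x
    split_ifs <;> simp [inner_smul_right, real_inner_comm]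
  filter_upwards [hae] with x hx hfx
  simpa [hfx] using hx

end WeakGradientZero

/-! ### Lower semicontinuity of entropy. -/

section LowerSemicontinuity

open Filter Topology

variable {α : Type*} [MeasurableSpace α] {μ : Measure α}

/-- Fatou's lemma, available because `klFun` makes the integrand effectively nonnegative. The masses
`m n` vary since mollification and cutoff change the total mass. -/
theorem lintegral_klFun_le_of_tendsto {F : ℕ → α → ℝ} {f : α → ℝ} {m b : ℕ → ℝ} {m₀ b₀ : ℝ}
    (hF : ∀ n, AEStronglyMeasurable (F n) μ)
    (hlim : ∀ᵐ x ∂μ, Tendsto (fun n => F n x) atTop (𝓝 (f x)))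
    (hm : Tendsto m atTop (𝓝 m₀)) (hm₀ : m₀ ≠ 0) (hb : Tendsto b atTop (𝓝 b₀))
    (hle : ∀ᶠ n in atTop,
      ∫⁻ x, ENNReal.ofReal (m n * klFun (F n x / m n)) ∂μ ≤ ENNReal.ofReal (b n)) :
    ∫⁻ x, ENNReal.ofReal (m₀ * klFun (f x / m₀)) ∂μ ≤ ENNReal.ofReal b₀ := by
  have hpt : ∀ᵐ x ∂μ, Tendsto (fun n => ENNReal.ofReal (m n * klFun (F n x / m n))) atTop
      (𝓝 (ENNReal.ofReal (m₀ * klFun (f x / m₀)))) := by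
    filter_upwards [hlim] with x hx
    exact ENNReal.tendsto_ofReal
      (hm.mul ((continuous_klFun.tendsto _).comp (hx.div hm hm₀)))
  calc ∫⁻ x, ENNReal.ofReal (m₀ * klFun (f x / m₀)) ∂μ
      = ∫⁻ x, liminf (fun n => ENNReal.ofReal (m n * klFun (F n x / m n))) atTop ∂μ :=
        lintegral_congr_ae (hpt.mono fun x hx => hx.liminf_eq.symm)
    _ ≤ liminf (fun n => ∫⁻ x, ENNReal.ofReal (m n * klFun (F n x / m n)) ∂μ) atTop :=
        lintegral_liminf_le' fun n => (((measurable_klFun.comp_aemeasurable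
          ((hF n).aemeasurable.div_const _)).const_mul _).ennreal_ofReal)
    _ ≤ liminf (fun n => ENNReal.ofReal (b n)) atTop := liminf_le_liminf hle
    _ = ENNReal.ofReal b₀ := (ENNReal.tendsto_ofReal hb).liminf_eq

theorem lintegral_klFun_eq_entropy [IsProbabilityMeasure μ] {f : α → ℝ} {a b : ℝ} (ha : 0 < a)
    (hf : Measurable f) (h1 : ∀ x, a ≤ f x) (h2 : ∀ x, f x ≤ b) :
    ∫⁻ x, ENNReal.ofReal ((∫ y, f y ∂μ) * klFun (f x / ∫ y, f y ∂μ)) ∂μ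
      = ENNReal.ofReal (entropy μ f) := by
  have hi := integrable_of_bounds (μ := μ) hf.aestronglyMeasurable h1 h2
  have hl := integrable_mul_log_of_bounds (μ := μ) ha hf h1 h2
  have hm : 0 < ∫ y, f y ∂μ := ha.trans_le (integral_mem_bounds hf.aestronglyMeasurable h1 h2).1
  set m := ∫ y, f y ∂μ with hm_def
  have e (x : α) : m * klFun (f x / m)
      = f x * Real.log (f x) - (f x * (Real.log m + 1) - m) := by
    rw [klFun_apply, Real.log_div (ha.trans_le (h1 x)).ne' hm.ne']
    field_simp
    ring
  have hlin : Integrable (fun x => f x * (Real.log m + 1) - m) μ :=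
    (hi.mul_const _).sub (integrable_const _)
  rw [← ofReal_integral_eq_lintegral_ofReal]
  · congr 1
    simp_rw [e]
    rw [integral_sub hl hlin, integral_sub (hi.mul_const _) (integrable_const _),
      integral_mul_const, ← hm_def, entropy]
    simp only [integral_const, probReal_univ, smul_eq_mul, one_mul]
    ring
  · simp_rw [e]
    exact hl.sub hlin
  · exact ae_of_all _ fun x =>
      mul_nonneg hm.le (klFun_nonneg (div_nonneg (ha.le.trans (h1 x)) hm.le))

end LowerSemicontinuity

/-! ### From smooth functions to compactly supported ones with a weak gradient. -/

section CompactSupport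

open Filter Topology

variable {d : ℕ}

/-- A positive bounded continuous density whose logarithm is Lipschitz near every ball. -/
structure IsRegularDensity (q : Eucl d → ℝ) : Prop where
  continuous : Continuous q
  pos : ∀ x, 0 < q x
  bounded : ∃ B, ∀ x, q x ≤ B
  log_lipschitz : ∀ r : ℝ, ∃ c : ℝ, 0 ≤ c ∧ ∀ x t, ‖x‖ ≤ r → ‖t‖ ≤ 1 →
    q (x + t) ≤ Real.exp (c * ‖t‖) * q x ∧ q x ≤ Real.exp (c * ‖t‖) * q (x + t)

variable {q : Eucl d → ℝ}

theorem IsRegularDensity.integral_withDensity (hq : IsRegularDensity q) (f : Eucl d → ℝ) :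
    ∫ x, f x ∂(volume.withDensity fun x => ENNReal.ofReal (q x)) = ∫ x, f x * q x := by
  rw [integral_withDensity_eq_integral_toReal_smul hq.continuous.measurable.ennreal_ofReal
    (ae_of_all _ fun x => ENNReal.ofReal_lt_top)]
  congr 1
  ext x
  rw [ENNReal.toReal_ofReal (hq.pos x).le, smul_eq_mul, mul_comm]

theorem IsRegularDensity.integrable_withDensity_iff (hq : IsRegularDensity q) (f : Eucl d → ℝ) :
    Integrable f (volume.withDensity fun x => ENNReal.ofReal (q x))
      ↔ Integrable fun x => f x * q x := by
  rw [MeasureTheory.integrable_withDensity_iff hq.continuous.measurable.ennreal_ofReal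
    (ae_of_all _ fun x => ENNReal.ofReal_lt_top)]
  simp_rw [ENNReal.toReal_ofReal (hq.pos _).le]

theorem IsRegularDensity.integrable_mul (hq : IsRegularDensity q) {f : Eucl d → ℝ}
    (hf : Integrable f) : Integrable fun x => f x * q x := by
  obtain ⟨B, hB⟩ := hq.bounded
  exact hf.mul_bdd (c := B) hq.continuous.aestronglyMeasurable
    (ae_of_all _ fun x => by rw [Real.norm_of_nonneg (hq.pos x).le]; exact hB x)

/-- By Fubini, mollifying `f` amounts to shifting `q` by at most the mollifier radius, which changes
`q` by a factor close to 1 on the ball carrying `f`. -/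
theorem IsRegularDensity.integral_mollify_mul_bounds (hq : IsRegularDensity q) {f : Eucl d → ℝ}
    (hf : Integrable f) (h0 : ∀ x, 0 ≤ f x) {r c : ℝ} (hr : ∀ x, r < ‖x‖ → f x = 0) (hc0 : 0 ≤ c)
    (hc : ∀ x t : Eucl d, ‖x‖ ≤ r → ‖t‖ ≤ 1 →
      q (x + t) ≤ Real.exp (c * ‖t‖) * q x ∧ q x ≤ Real.exp (c * ‖t‖) * q (x + t)) (n : ℕ) :
    ∫ x, mollify n f x * q x ≤ Real.exp (c * (mollifier d n).rOut) * ∫ x, f x * q x ∧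
    Real.exp (-(c * (mollifier d n).rOut)) * ∫ x, f x * q x ≤ ∫ x, mollify n f x * q x := by
  obtain ⟨B, hB⟩ := hq.bounded
  set ρ : Eucl d → ℝ := (mollifier d n).normed volume with hρ
  set δ := (mollifier d n).rOut with hδ
  have ρ0 (t : Eucl d) : 0 ≤ ρ t := ContDiffBump.nonneg_normed _ t
  have ρi : Integrable ρ := ContDiffBump.integrable_normed _
  have ρ1 : ∫ t, ρ t = 1 := ContDiffBump.integral_normed _
  have ρs (t : Eucl d) (ht : ρ t ≠ 0) : ‖t‖ ≤ δ := by
    have : t ∈ Function.support ρ := ht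
    rw [hρ, ContDiffBump.support_normed_eq, Metric.mem_ball, dist_zero_right] at this
    exact this.le
  have hi : Integrable (fun p : Eucl d × Eucl d => ρ p.2 * f (p.1 - p.2) * q p.1)
      (volume.prod volume) := by
    have := ρi.convolution_integrand (ContinuousLinearMap.lsmul ℝ ℝ) hf
    exact this.mul_bdd (c := B) (hq.continuous.comp continuous_fst).aestronglyMeasurable
      (ae_of_all _ fun p => by rw [Real.norm_of_nonneg (hq.pos _).le]; exact hB _)
  have hT (t : Eucl d) : ∫ x, ρ t * f (x - t) * q x = ρ t * ∫ x, f x * q (x + t) := by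
    rw [← integral_const_mul, ← integral_add_right_eq_self _ t]
    congr 1
    ext x
    rw [add_sub_cancel_right, mul_assoc]
  have e1 : ∫ x, mollify n f x * q x = ∫ t, ρ t * ∫ x, f x * q (x + t) := by
    simp_rw [← hT]
    rw [← integral_integral_swap hi]
    congr 1
    ext x
    rw [integral_mul_const]
    rfl
  have hI : Integrable fun t => ρ t * ∫ x, f x * q (x + t) := by
    simp_rw [← hT]
    exact hi.integral_prod_right
  have hfi (t : Eucl d) : Integrable fun x => f x * q (x + t) :=
    hf.mul_bdd (c := B) (hq.continuous.comp (by fun_prop)).aestronglyMeasurable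
      (ae_of_all _ fun x => by rw [Real.norm_of_nonneg (hq.pos _).le]; exact hB _)
  have hA : 0 ≤ ∫ x, f x * q x := integral_nonneg fun x => mul_nonneg (h0 x) (hq.pos x).le
  have hexp (t : Eucl d) (ht : ‖t‖ ≤ δ) : Real.exp (c * ‖t‖) ≤ Real.exp (c * δ) :=
    Real.exp_le_exp.2 (mul_le_mul_of_nonneg_left ht hc0)
  have up (t : Eucl d) (ht : ‖t‖ ≤ δ) :
      ∫ x, f x * q (x + t) ≤ Real.exp (c * δ) * ∫ x, f x * q x := by
    rw [← integral_const_mul]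
    refine integral_mono (hfi t) ((hq.integrable_mul hf).const_mul _) fun x => ?_
    simp only
    by_cases hx : r < ‖x‖
    · simp [hr x hx]
    · have := (hc x t (not_lt.1 hx) (ht.trans (mollifier_rOut_le_one d n))).1
      have h2 := this.trans (mul_le_mul_of_nonneg_right (hexp t ht) (hq.pos x).le)
      linarith [mul_le_mul_of_nonneg_left h2 (h0 x)]
  have lo (t : Eucl d) (ht : ‖t‖ ≤ δ) :
      ∫ x, f x * q x ≤ Real.exp (c * δ) * ∫ x, f x * q (x + t) := by
    rw [← integral_const_mul]
    refine integral_mono (hq.integrable_mul hf) ((hfi t).const_mul _) fun x => ?_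
    simp only
    by_cases hx : r < ‖x‖
    · simp [hr x hx]
    · have := (hc x t (not_lt.1 hx) (ht.trans (mollifier_rOut_le_one d n))).2
      have h2 := this.trans (mul_le_mul_of_nonneg_right (hexp t ht) (hq.pos (x + t)).le)
      linarith [mul_le_mul_of_nonneg_left h2 (h0 x)]
  rw [e1]
  constructor
  · have := integral_mono hI (ρi.mul_const (Real.exp (c * δ) * ∫ x, f x * q x)) fun t => ?_
    · rwa [integral_mul_const, ρ1, one_mul] at this
    · by_cases ht : ρ t = 0
      · simp [ht]
      · exact mul_le_mul_of_nonneg_left (up t (ρs t ht)) (ρ0 t)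
  · have := integral_mono (ρi.mul_const (Real.exp (-(c * δ)) * ∫ x, f x * q x)) hI fun t => ?_
    · rwa [integral_mul_const, ρ1, one_mul] at this
    · by_cases ht : ρ t = 0
      · simp [ht]
      · refine mul_le_mul_of_nonneg_left ?_ (ρ0 t)
        rw [Real.exp_neg, inv_mul_le_iff₀ (Real.exp_pos _)]
        exact lo t (ρs t ht)

/-- Jensen's inequality for `‖g‖² / f` again: `2 s ‖g‖ ≤ J + s² f` is mollified and then used with
`s = G / (U + ε)`. -/
theorem norm_sq_mollify_div_le {f J : Eucl d → ℝ} {g : Eucl d → Eucl d} (hf : Integrable f)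
    (hg : Integrable g) (hJ : Integrable J) (h0 : ∀ x, 0 ≤ f x)
    (hfg : ∀ᵐ x, ‖g x‖ ^ 2 ≤ f x * J x) (hJ0 : ∀ x, 0 ≤ J x) {ε : ℝ} (hε : 0 < ε) (n : ℕ)
    (x : Eucl d) :
    ‖mollify n g x‖ ^ 2 / (mollify n f x + ε) ≤ mollify n J x := by
  have key (s : ℝ) (hs : 0 ≤ s) :
      2 * s * mollify n (fun y => ‖g y‖) x ≤ mollify n J x + s ^ 2 * mollify n f x := by
    have i1 := integrable_mollify_integrand n hf.locallyIntegrable x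
    have i2 := integrable_mollify_integrand n hg.norm.locallyIntegrable x
    have i3 := integrable_mollify_integrand n hJ.locallyIntegrable x
    simp only [mollify_apply]
    rw [← integral_const_mul, ← integral_const_mul, ← integral_add i3 (i1.const_mul _)]
    refine integral_mono_ae (i2.const_mul _) (i3.add (i1.const_mul _)) ?_
    filter_upwards [(quasiMeasurePreserving_sub_left_of_right_invariant volume x).ae hfg] with t ht
    have hρ := (mollifier d n).nonneg_normed (μ := volume) t
    have h1 : 2 * s * ‖g (x - t)‖ ≤ J (x - t) + s ^ 2 * f (x - t) := by
      have h2 : (2 * s * ‖g (x - t)‖) ^ 2 ≤ (J (x - t) + s ^ 2 * f (x - t)) ^ 2 := by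
        nlinarith [sq_nonneg (J (x - t) - s ^ 2 * f (x - t)), mul_le_mul_of_nonneg_left ht
          (sq_nonneg s)]
      exact le_of_abs_le
        (abs_le_of_sq_le_sq h2 (add_nonneg (hJ0 _) (mul_nonneg (sq_nonneg s) (h0 _))))
    have := mul_le_mul_of_nonneg_left h1 hρ
    simp only [smul_eq_mul]
    linarith
  set G := mollify n (fun y => ‖g y‖) x
  set U := mollify n f x
  have hU : 0 ≤ U := mollify_nonneg n h0 x
  have hG : ‖mollify n g x‖ ≤ G := norm_mollify_le n x
  have hG0 : 0 ≤ G := (norm_nonneg _).trans hG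
  have hp : 0 < U + ε := by linarith
  calc ‖mollify n g x‖ ^ 2 / (U + ε) ≤ G ^ 2 / (U + ε) := by gcongr
    _ = 2 * (G / (U + ε)) * G - (G / (U + ε)) ^ 2 * (U + ε) := by field_simp; ring
    _ ≤ 2 * (G / (U + ε)) * G - (G / (U + ε)) ^ 2 * U := by
      have : 0 ≤ (G / (U + ε)) ^ 2 * ε := by positivity
      linarith
    _ ≤ mollify n J x := by linarith [key (G / (U + ε)) (by positivity)]

/-- The logarithmic Sobolev inequality with constant `C` for regularized test functions. -/
def SmoothLSI (Q : Measure (Eucl d)) (C : ℝ) : Prop :=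
  ∀ u : Eucl d → ℝ, ContDiff ℝ ∞ u → HasCompactSupport u → (∀ x, 0 ≤ u x) → ∀ ε : ℝ, 0 < ε →
    entropy Q (fun x => u x + ε) ≤ C * ∫ x, ‖fderiv ℝ u x‖ ^ 2 / (u x + ε) ∂Q

theorem SmoothLSI.lintegral_klFun_le_of_hasCompactSupport {Q : Measure (Eucl d)}
    [IsProbabilityMeasure Q] {C : ℝ} (hQ : SmoothLSI Q C) (hC : 0 ≤ C) (hq : IsRegularDensity q)
    (hQq : Q = volume.withDensity fun x => ENNReal.ofReal (q x)) {f : Eucl d → ℝ}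
    {g : Eucl d → Eucl d} (h : HasWeakGradient f g) (hf : Integrable f) (hg : Integrable g)
    (h0 : ∀ x, 0 ≤ f x) (hs : HasCompactSupport f)
    (hJ : Integrable (fun x => (f x)⁻¹ * ‖g x‖ ^ 2) Q) (hm : ∫ x, f x ∂Q ≠ 0) :
    ∫⁻ x, ENNReal.ofReal ((∫ y, f y ∂Q) * klFun (f x / ∫ y, f y ∂Q)) ∂Q
      ≤ ENNReal.ofReal (C * ∫ x, (f x)⁻¹ * ‖g x‖ ^ 2 ∂Q) := by
  have hqi := hq.integral_withDensity
  have hqn := hq.integrable_withDensity_iff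
  rw [← hQq] at hqi hqn
  obtain ⟨r, hr⟩ := hs.isCompact.isBounded.subset_closedBall 0
  have hr' (x : Eucl d) (hx : r < ‖x‖) : f x = 0 := by
    by_contra hne
    have := hr (subset_tsupport f hne)
    rw [mem_closedBall_zero_iff] at this
    linarith
  obtain ⟨c, hc0, hc⟩ := hq.log_lipschitz r
  set J : Eucl d → ℝ := fun x => (f x)⁻¹ * ‖g x‖ ^ 2 with hJdef
  have hJ0 (x : Eucl d) : 0 ≤ J x := mul_nonneg (inv_nonneg.2 (h0 x)) (sq_nonneg _)
  have hJr (x : Eucl d) (hx : r < ‖x‖) : J x = 0 := by simp [hJdef, hr' x hx]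
  -- On the closed ball carrying `f`, the density `q` is bounded away from zero, so integrability
  -- passes from `Q` to Lebesgue measure.
  have hJi : Integrable J := by
    have h1 := ((hqn J).1 hJ).integrableOn (s := Metric.closedBall 0 r)
    have h2 := h1.mul_continuousOn (g' := fun x => (q x)⁻¹)
      (hq.continuous.inv₀ fun x => (hq.pos x).ne').continuousOn (isCompact_closedBall 0 r)
    simp only [mul_assoc, mul_inv_cancel₀ (hq.pos _).ne', mul_one] at h2
    refine (integrableOn_iff_integrable_of_support_subset fun x hx => ?_).1 h2
    rw [mem_closedBall_zero_iff]
    by_contra hn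
    exact hx (hJr x (not_le.1 hn))
  -- As `0⁻¹ = 0`, `J` does not see `g` where `f = 0`; the inequality there rests on the vanishing
  -- of the weak gradient.
  have hfg : ∀ᵐ x, ‖g x‖ ^ 2 ≤ f x * J x := by
    filter_upwards [h.ae_eq_zero_of_eq_zero hf hg h0] with x hx
    by_cases hfx : f x = 0
    · simp [hx hfx, hfx]
    · simp only [hJdef]
      rw [mul_inv_cancel_left₀ hfx]
  set ε : ℕ → ℝ := fun n => 1 / ((n : ℝ) + 1) with hε
  have εpos (n : ℕ) : 0 < ε n := by positivity
  have εlim : Tendsto ε atTop (𝓝 0) := tendsto_one_div_add_atTop_nhds_zero_nat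
  set δ : ℕ → ℝ := fun n => (mollifier d n).rOut
  have δlim : Tendsto δ atTop (𝓝 0) := tendsto_mollifier_rOut d
  have expup : Tendsto (fun n => Real.exp (c * δ n)) atTop (𝓝 1) := by
    have := (Real.continuous_exp.tendsto _).comp (δlim.const_mul c)
    simpa [Function.comp_def] using this
  have explo : Tendsto (fun n => Real.exp (-(c * δ n))) atTop (𝓝 1) := by
    have := (Real.continuous_exp.tendsto _).comp (δlim.const_mul c).neg
    simpa [Function.comp_def] using this
  have uQ (n : ℕ) : Integrable (mollify n f) Q :=
    (hqn _).2 (hq.integrable_mul (integrable_mollify n hf))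
  have hsm (n : ℕ) : ContDiff ℝ ∞ (mollify n f) := contDiff_mollify n h.1
  have mlim : Tendsto (fun n => ∫ x, (mollify n f x + ε n) ∂Q) atTop (𝓝 (∫ x, f x ∂Q)) := by
    have e (n : ℕ) : ∫ x, (mollify n f x + ε n) ∂Q = (∫ x, mollify n f x * q x) + ε n := by
      rw [integral_add (uQ n) (integrable_const _), hqi]
      simp
    simp_rw [e, hqi f]
    have l1 : Tendsto (fun n => ∫ x, mollify n f x * q x) atTop (𝓝 (∫ x, f x * q x)) := by
      have lo := explo.mul_const (∫ x, f x * q x)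
      have up := expup.mul_const (∫ x, f x * q x)
      rw [one_mul] at lo up
      exact tendsto_of_tendsto_of_tendsto_of_le_of_le lo up
        (fun n => (hq.integral_mollify_mul_bounds hf h0 hr' hc0 hc n).2)
        (fun n => (hq.integral_mollify_mul_bounds hf h0 hr' hc0 hc n).1)
    simpa using l1.add εlim
  have blim : Tendsto (fun n => C * (Real.exp (c * δ n) * ∫ x, J x ∂Q)) atTop
      (𝓝 (C * ∫ x, J x ∂Q)) := by
    simpa using (expup.mul_const (∫ x, J x ∂Q)).const_mul C
  refine lintegral_klFun_le_of_tendsto (F := fun n x => mollify n f x + ε n)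
    (fun n => ((hsm n).continuous.add continuous_const).aestronglyMeasurable) ?_ mlim hm blim
    (Eventually.of_forall fun n => ?_)
  · have hac : Q ≪ volume := hQq ▸ withDensity_absolutelyContinuous _ _
    refine hac.ae_le ?_
    filter_upwards [ae_tendsto_mollify hf.locallyIntegrable] with x hx
    simpa using hx.add εlim
  · have hcs := hasCompactSupport_mollify n hs
    have hu0 (x : Eucl d) : 0 ≤ mollify n f x := mollify_nonneg n h0 x
    obtain ⟨M, L, K, hb⟩ := slopeBound_of_contDiff (hsm n) hcs hu0 (ε n)
    rw [lintegral_klFun_eq_entropy (εpos n) hb.continuous.measurable hb.lower hb.upper]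
    refine ENNReal.ofReal_le_ofReal ((hQ _ (hsm n) hcs hu0 _ (εpos n)).trans
      (mul_le_mul_of_nonneg_left ?_ hC))
    have i1 : Integrable (mollify n J) Q := (hqn _).2 (hq.integrable_mul (integrable_mollify n hJi))
    calc ∫ x, ‖fderiv ℝ (mollify n f) x‖ ^ 2 / (mollify n f x + ε n) ∂Q
        ≤ ∫ x, mollify n J x ∂Q := by
          refine integral_mono_of_nonneg (ae_of_all _ fun x => ?_) i1 (ae_of_all _ fun x => ?_)
          · exact div_nonneg (sq_nonneg _) (by linarith [hu0 x, εpos n])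
          · have e : ‖fderiv ℝ (mollify n f) x‖ = ‖mollify n g x‖ := by
              rw [(h.hasGradientAt_mollify n x).hasFDerivAt.fderiv, LinearIsometryEquiv.norm_map]
            simp only [e]
            exact norm_sq_mollify_div_le hf hg hJi h0 hfg hJ0 (εpos n) n x
      _ ≤ _ := by
          rw [hqi, hqi]
          exact (hq.integral_mollify_mul_bounds hJi hJ0 hJr hc0 hc n).1

end CompactSupport

/-! ### Product rule for weak gradients and cutoff functions. -/

section Cutoff

open Filter Topology

variable {d : ℕ} {f : Eucl d → ℝ} {g : Eucl d → Eucl d}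

theorem continuous_gradient_of_contDiff {χ : Eucl d → ℝ} (hχ : ContDiff ℝ ∞ χ) :
    Continuous (gradient χ) :=
  (InnerProductSpace.toDual ℝ (Eucl d)).symm.continuous.comp (hχ.continuous_fderiv (by simp))

theorem hasCompactSupport_gradient {χ : Eucl d → ℝ} (hc : HasCompactSupport χ) :
    HasCompactSupport (gradient χ) :=
  (hc.fderiv ℝ).comp_left (map_zero (InnerProductSpace.toDual ℝ (Eucl d)).symm)

theorem hasGradientAt_of_contDiff {χ : Eucl d → ℝ} (hχ : ContDiff ℝ ∞ χ) (x : Eucl d) :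
    HasGradientAt χ (gradient χ x) x :=
  (hχ.differentiable (by simp) x).hasGradientAt

theorem gradient_mul {χ φ : Eucl d → ℝ} (hχ : ContDiff ℝ ∞ χ) (hφ : ContDiff ℝ ∞ φ) (x : Eucl d) :
    gradient (fun y => χ y * φ y) x = χ x • gradient φ x + φ x • gradient χ x := by
  apply HasGradientAt.gradient
  rw [hasGradientAt_iff_hasFDerivAt, map_add, map_smul, map_smul]
  exact (hasGradientAt_of_contDiff hχ x).hasFDerivAt.mul (hasGradientAt_of_contDiff hφ x).hasFDerivAt

theorem HasWeakGradient.integrable_mul (h : HasWeakGradient f g) {χ : Eucl d → ℝ}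
    (hχ : ContDiff ℝ ∞ χ) (hc : HasCompactSupport χ) : Integrable (fun x => χ x * f x) :=
  h.1.integrable_smul_left_of_hasCompactSupport hχ.continuous hc

theorem HasWeakGradient.integrable_smul_add (h : HasWeakGradient f g) {χ : Eucl d → ℝ}
    (hχ : ContDiff ℝ ∞ χ) (hc : HasCompactSupport χ) :
    Integrable (fun x => χ x • g x + f x • gradient χ x) :=
  (h.2.1.integrable_smul_left_of_hasCompactSupport hχ.continuous hc).add
    (h.1.integrable_smul_right_of_hasCompactSupport (continuous_gradient_of_contDiff hχ)
      (hasCompactSupport_gradient hc))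

/-- The weak gradient identity of `f` is tested against `χ φ`. -/
theorem HasWeakGradient.mul (h : HasWeakGradient f g) {χ : Eucl d → ℝ}
    (hχ : ContDiff ℝ ∞ χ) (hc : HasCompactSupport χ) :
    HasWeakGradient (fun x => χ x * f x) (fun x => χ x • g x + f x • gradient χ x) := by
  refine ⟨(h.integrable_mul hχ hc).locallyIntegrable,
    (h.integrable_smul_add hχ hc).locallyIntegrable, fun φ hφ hφc => ?_⟩
  have hp : ContDiff ℝ ∞ fun x => χ x * φ x := hχ.mul hφ
  have hpc : HasCompactSupport fun x => χ x * φ x := hc.mul_right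
  have key := h.2.2 _ hp hpc
  have i1 : Integrable fun x => f x • gradient (fun x => χ x * φ x) x :=
    h.1.integrable_smul_right_of_hasCompactSupport (continuous_gradient_of_contDiff hp)
      (hasCompactSupport_gradient hpc)
  have i2 : Integrable fun x => f x • (φ x • gradient χ x) :=
    h.1.integrable_smul_right_of_hasCompactSupport
      (hφ.continuous.smul (continuous_gradient_of_contDiff hχ)) hφc.smul_right
  have i3 : Integrable fun x => (χ x * φ x) • g x :=
    h.2.1.integrable_smul_left_of_hasCompactSupport hp.continuous hpc
  have e1 : ∫ x, (χ x * f x) • gradient φ x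
      = (∫ x, f x • gradient (fun x => χ x * φ x) x) - ∫ x, f x • (φ x • gradient χ x) := by
    rw [← integral_sub i1 i2]
    congr 1
    ext1 x
    rw [gradient_mul hχ hφ, smul_add, add_sub_cancel_right, smul_smul, mul_comm]
  have e2 : ∫ x, φ x • (χ x • g x + f x • gradient χ x)
      = (∫ x, (χ x * φ x) • g x) + ∫ x, f x • (φ x • gradient χ x) := by
    rw [← integral_add i3 i2]
    congr 1
    ext1 x
    simp only [smul_add, smul_smul, mul_comm]
  rw [e1, e2, key, neg_add, sub_eq_add_neg]

/-- Smooth cutoff functions with gradients tending uniformly to zero. -/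
theorem exists_cutoff (d : ℕ) : ∃ (η : ℕ → Eucl d → ℝ) (b : ℕ → ℝ), Tendsto b atTop (𝓝 0) ∧
    (∀ n, ContDiff ℝ ∞ (η n)) ∧ (∀ n, HasCompactSupport (η n)) ∧ (∀ n x, |η n x| ≤ 1) ∧
    (∀ n x, ‖gradient (η n) x‖ ≤ b n) ∧ ∀ x, Tendsto (fun n => η n x) atTop (𝓝 1) := by
  let ψ : ContDiffBump (0 : Eucl d) := ⟨1, 2, one_pos, one_lt_two⟩
  have ψs : ContDiff ℝ ∞ ψ := ψ.contDiff
  obtain ⟨c, hc⟩ := (ψs.continuous_fderiv (by simp)).bounded_above_of_compact_support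
    (ψ.hasCompactSupport.fderiv ℝ)
  have slim : Tendsto (fun n : ℕ => 1 / ((n : ℝ) + 1)) atTop (𝓝 0) :=
    tendsto_one_div_add_atTop_nhds_zero_nat
  refine ⟨fun n x => ψ ((1 / ((n : ℝ) + 1)) • x), fun n => 1 / ((n : ℝ) + 1) * c,
    by simpa using slim.mul_const c, fun n => ψs.comp (contDiff_const_smul _),
    fun n => ψ.hasCompactSupport.comp_smul (by positivity), fun n x => ?_, fun n x => ?_,
    fun x => ?_⟩
  · rw [abs_of_nonneg ψ.nonneg]
    exact ψ.le_one
  · have hd := (ψs.differentiable (by simp) ((1 / ((n : ℝ) + 1)) • x)).hasFDerivAt.comp x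
      ((hasFDerivAt_id x).const_smul (1 / ((n : ℝ) + 1)))
    have e : ‖gradient (fun x => ψ ((1 / ((n : ℝ) + 1)) • x)) x‖
        = ‖fderiv ℝ (fun x => ψ ((1 / ((n : ℝ) + 1)) • x)) x‖ := by
      rw [← toDual_gradient, LinearIsometryEquiv.norm_map]
    have e2 : fderiv ℝ (fun x => ψ ((1 / ((n : ℝ) + 1)) • x)) x
        = (1 / ((n : ℝ) + 1)) • fderiv ℝ ψ ((1 / ((n : ℝ) + 1)) • x) := by
      refine hd.fderiv.trans ?_
      ext v
      simp
    rw [e, e2, norm_smul, Real.norm_of_nonneg (by positivity)]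
    exact mul_le_mul_of_nonneg_left (hc _) (by positivity)
  · have h1 : Tendsto (fun n : ℕ => (1 / ((n : ℝ) + 1)) • x) atTop (𝓝 0) := by
      simpa using slim.smul_const x
    have h2 := (ψs.continuous.tendsto 0).comp h1
    rwa [ψ.one_of_mem_closedBall (Metric.mem_closedBall_self ψ.rIn_pos.le)] at h2

/-- The cutoff is a square `η²`, so its gradient `2 η ∇η` has a factor `η` that compensates the
division by `η²`. The convention `0⁻¹ = 0` settles the degenerate cases. -/
theorem fisher_cutoff_le {η c t : ℝ} {y v : Eucl d} (ht : 0 ≤ t) (hη : |η| ≤ 1) (hv : ‖v‖ ≤ c) :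
    (η * η * t)⁻¹ * ‖(η * η) • y + t • (η • v + η • v)‖ ^ 2
      ≤ 2 * (t⁻¹ * ‖y‖ ^ 2) + 8 * c ^ 2 * t := by
  rcases ht.eq_or_lt with rfl | ht
  · simp
  by_cases h0 : η = 0
  · subst h0
    simp only [zero_mul, inv_zero]
    positivity
  have e : (η * η) • y + t • (η • v + η • v) = η • (η • y + (2 * t) • v) := by module
  rw [e, norm_smul, mul_pow, Real.norm_eq_abs, sq_abs]
  have e2 : (η * η * t)⁻¹ * (η ^ 2 * ‖η • y + (2 * t) • v‖ ^ 2)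
      = t⁻¹ * ‖η • y + (2 * t) • v‖ ^ 2 := by field_simp
  rw [e2]
  have h1 : ‖η • y + (2 * t) • v‖ ≤ ‖y‖ + 2 * t * c := by
    refine (norm_add_le _ _).trans (add_le_add ?_ ?_)
    · rw [norm_smul, Real.norm_eq_abs]
      exact mul_le_of_le_one_left (norm_nonneg _) hη
    · rw [norm_smul, Real.norm_of_nonneg (by positivity)]
      gcongr
  have h2 : ‖η • y + (2 * t) • v‖ ^ 2 ≤ 2 * (‖y‖ ^ 2 + (2 * t * c) ^ 2) :=
    (pow_le_pow_left₀ (norm_nonneg _) h1 2).trans add_sq_le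
  calc t⁻¹ * ‖η • y + (2 * t) • v‖ ^ 2 ≤ t⁻¹ * (2 * (‖y‖ ^ 2 + (2 * t * c) ^ 2)) := by gcongr
    _ = _ := by field_simp; ring

end Cutoff

/-! ### Removal of the compact support, and the inequality for measures. -/

section Extension

open Filter Topology

variable {d : ℕ} {q : Eucl d → ℝ}

theorem SmoothLSI.lintegral_klFun_le {Q : Measure (Eucl d)} [IsProbabilityMeasure Q] {C : ℝ}
    (hQ : SmoothLSI Q C) (hC : 0 < C) (hq : IsRegularDensity q)
    (hQq : Q = volume.withDensity fun x => ENNReal.ofReal (q x)) {f : Eucl d → ℝ}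
    {g : Eucl d → Eucl d} (h : HasWeakGradient f g) (h0 : ∀ x, 0 ≤ f x) (hf : Integrable f Q)
    (hf1 : ∫ x, f x ∂Q = 1) :
    ∫⁻ x, ENNReal.ofReal (klFun (f x)) ∂Q
      ≤ ENNReal.ofReal (2 * C) * ∫⁻ x, ENNReal.ofReal ((f x)⁻¹ * ‖g x‖ ^ 2) ∂Q := by
  have hac : Q ≪ volume := hQq ▸ withDensity_absolutelyContinuous _ _
  set J : Eucl d → ℝ := fun x => (f x)⁻¹ * ‖g x‖ ^ 2 with hJdef
  have hJ0 (x : Eucl d) : 0 ≤ J x := mul_nonneg (inv_nonneg.2 (h0 x)) (sq_nonneg _)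
  have hgm : AEStronglyMeasurable g Q := h.2.1.aestronglyMeasurable.mono_ac hac
  have hJm : AEStronglyMeasurable J Q := hf.1.inv₀.mul (hgm.norm.pow 2)
  by_cases hfin : ∫⁻ x, ENNReal.ofReal (J x) ∂Q = (⊤ : ℝ≥0∞)
  · rw [hfin, ENNReal.mul_top (ENNReal.ofReal_pos.2 (by positivity)).ne']
    exact le_top
  have hJ : Integrable J Q := (lintegral_ofReal_ne_top_iff_integrable hJm (ae_of_all _ hJ0)).1 hfin
  rw [← ofReal_integral_eq_lintegral_ofReal hJ (ae_of_all _ hJ0),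
    ← ENNReal.ofReal_mul (by positivity)]
  obtain ⟨η, b, hb, ηs, ηc, η1, ηg, ηlim⟩ := exists_cutoff d
  have χs (n : ℕ) : ContDiff ℝ ∞ fun x => η n x * η n x := (ηs n).mul (ηs n)
  have χc (n : ℕ) : HasCompactSupport fun x => η n x * η n x := (ηc n).mul_right
  have χ0 (n : ℕ) (x : Eucl d) : 0 ≤ η n x * η n x := mul_self_nonneg _
  have χ1 (n : ℕ) (x : Eucl d) : η n x * η n x ≤ 1 := by
    have := (sq_le_one_iff_abs_le_one (η n x)).2 (η1 n x)
    rwa [sq] at this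
  have χlim (x : Eucl d) : Tendsto (fun n => η n x * η n x * f x) atTop (𝓝 (f x)) := by
    simpa using ((ηlim x).mul (ηlim x)).mul_const (f x)
  have fm (n : ℕ) : AEStronglyMeasurable (fun x => η n x * η n x * f x) Q :=
    (χs n).continuous.aestronglyMeasurable.mul hf.1
  set m : ℕ → ℝ := fun n => ∫ x, η n x * η n x * f x ∂Q
  have mlim : Tendsto m atTop (𝓝 1) := by
    rw [← hf1]
    refine tendsto_integral_of_dominated_convergence f fm hf
      (fun n => ae_of_all _ fun x => ?_) (ae_of_all _ χlim)
    rw [Real.norm_of_nonneg (mul_nonneg (χ0 n x) (h0 x))]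
    exact mul_le_of_le_one_left (h0 x) (χ1 n x)
  have blim : Tendsto (fun n => C * (2 * ∫ x, J x ∂Q + 8 * b n ^ 2)) atTop
      (𝓝 (2 * C * ∫ x, J x ∂Q)) := by
    have := (((hb.pow 2).const_mul 8).const_add (2 * ∫ x, J x ∂Q)).const_mul C
    convert this using 2
    ring
  have key := lintegral_klFun_le_of_tendsto fm (ae_of_all _ χlim) mlim one_ne_zero blim ?_
  · simpa using key
  -- The first cutoffs may miss the mass of `f`, so a nonzero mass is only available for large `n`.
  · filter_upwards [mlim.eventually_ne one_ne_zero] with n hn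
    have hbd (x : Eucl d) : (η n x * η n x * f x)⁻¹ *
        ‖(η n x * η n x) • g x + f x • gradient (fun x => η n x * η n x) x‖ ^ 2
          ≤ 2 * J x + 8 * b n ^ 2 * f x := by
      rw [gradient_mul (ηs n) (ηs n)]
      exact fisher_cutoff_le (h0 x) (η1 n x) (ηg n x)
    have hnn (x : Eucl d) : 0 ≤ (η n x * η n x * f x)⁻¹ *
        ‖(η n x * η n x) • g x + f x • gradient (fun x => η n x * η n x) x‖ ^ 2 :=
      mul_nonneg (inv_nonneg.2 (mul_nonneg (χ0 n x) (h0 x))) (sq_nonneg _)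
    have hmaj : Integrable (fun x => 2 * J x + 8 * b n ^ 2 * f x) Q :=
      (hJ.const_mul _).add (hf.const_mul _)
    have hJn : Integrable (fun x => (η n x * η n x * f x)⁻¹ *
        ‖(η n x * η n x) • g x + f x • gradient (fun x => η n x * η n x) x‖ ^ 2) Q := by
      refine hmaj.mono' ((fm n).inv₀.mul (((((χs n).continuous.aestronglyMeasurable.smul hgm).add
        (hf.1.smul (continuous_gradient_of_contDiff (χs n)).aestronglyMeasurable)).norm).pow 2))
        (ae_of_all _ fun x => ?_)
      rw [Real.norm_of_nonneg (hnn x)]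
      exact hbd x
    refine (hQ.lintegral_klFun_le_of_hasCompactSupport hC.le hq hQq (h.mul (χs n) (χc n))
      (h.integrable_mul (χs n) (χc n)) (h.integrable_smul_add (χs n) (χc n))
      (fun x => mul_nonneg (χ0 n x) (h0 x)) (χc n).mul_right hJn hn).trans
      (ENNReal.ofReal_le_ofReal (mul_le_mul_of_nonneg_left ?_ hC.le))
    refine (integral_mono hJn hmaj hbd).trans_eq ?_
    rw [integral_add (hJ.const_mul _) (hf.const_mul _), integral_const_mul, integral_const_mul, hf1,
      mul_one]

theorem SmoothLSI.logSobolev {Q : Measure (Eucl d)} [IsProbabilityMeasure Q] {C : ℝ}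
    (hQ : SmoothLSI Q C) (hC : 0 < C) (hq : IsRegularDensity q)
    (hQq : Q = volume.withDensity fun x => ENNReal.ofReal (q x)) :
    LogSobolev (1 / (4 * C)) Q := by
  intro P hP
  have hC2 : 1 / (2 * (1 / (4 * C))) = 2 * C := by field_simp; ring
  rw [hC2, relFisherInfo]
  have hpos : ENNReal.ofReal (2 * C) ≠ 0 := by simpa using hC
  -- Dividing by the constant isolates the infimum, so it suffices to treat each weak gradient; the
  -- empty family, with value `∞`, needs no separate case.
  rw [mul_comm, ← ENNReal.div_le_iff_le_mul (Or.inl hpos) (Or.inl ENNReal.ofReal_ne_top)]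
  refine le_iInf₂ fun g hg => ?_
  obtain ⟨hPQ, hw⟩ := hg
  rw [ENNReal.div_le_iff_le_mul (Or.inl hpos) (Or.inl ENNReal.ofReal_ne_top)]
  have hac : Q ≪ volume := hQq ▸ withDensity_absolutelyContinuous _ _
  have hf1 : ∫ x, (P.rnDeriv Q x).toReal ∂Q = 1 := by
    rw [Measure.integral_toReal_rnDeriv hPQ]
    simp
  have key := hQ.lintegral_klFun_le hC hq hQq hw (fun x => ENNReal.toReal_nonneg)
    Measure.integrable_toReal_rnDeriv hf1
  rw [klDiv_eq_lintegral_klFun_of_ac hPQ]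
  rw [mul_comm] at key
  refine key.trans_eq ?_
  have hgm : AEStronglyMeasurable g Q := hw.2.1.aestronglyMeasurable.mono_ac hac
  have hmeas : AEMeasurable (fun x => ‖((P.rnDeriv Q x).toReal)⁻¹ • g x‖ₑ ^ 2) Q :=
    ((Measure.measurable_rnDeriv P Q).ennreal_toReal.inv.aestronglyMeasurable.smul
      hgm).enorm.pow_const 2
  have : P.HaveLebesgueDecomposition Q := Measure.haveLebesgueDecomposition_of_sigmaFinite P Q
  -- Passing from `P` to `Q` multiplies the integrand by the density `s`, and `s ‖s⁻¹ g‖² = s⁻¹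
  -- ‖g‖²`, also at `s = 0`.
  rw [← lintegral_rnDeriv_mul hPQ hmeas]
  congr 1
  refine lintegral_congr_ae ?_
  filter_upwards [Measure.rnDeriv_lt_top P Q] with x hx
  set s := (P.rnDeriv Q x).toReal with hs
  have hs0 : 0 ≤ s := ENNReal.toReal_nonneg
  have e : P.rnDeriv Q x = ENNReal.ofReal s := (ENNReal.ofReal_toReal hx.ne).symm
  rw [e, ← ofReal_norm, ← ENNReal.ofReal_pow (norm_nonneg _), ← ENNReal.ofReal_mul hs0, norm_smul,
    Real.norm_of_nonneg (inv_nonneg.2 hs0)]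
  congr 1
  rcases hs0.eq_or_lt with h | h
  · rw [← h]; simp
  · field_simp

end Extension

/-! ### The mixture potential: parameter gradient, regularity and uniform constant. -/

section Potential

variable {d p : ℕ} {η : ℝ} {z : Fin p → Eucl d}

theorem shiftedLogistic_mem (hη1 : η < 1) (t : ℝ) :
    η ≤ shiftedLogistic η t ∧ shiftedLogistic η t ≤ 1 := by
  have h1 : 0 < 1 + Real.exp (-t) := by positivity
  have h2 : 1 / (1 + Real.exp (-t)) ≤ 1 := by
    rw [div_le_one h1]
    linarith [Real.exp_pos (-t)]
  have h3 : 0 ≤ 1 / (1 + Real.exp (-t)) := by positivity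
  unfold shiftedLogistic
  constructor <;> nlinarith

theorem hasDerivAt_shiftedLogistic (η t : ℝ) :
    HasDerivAt (shiftedLogistic η)
      ((1 - η) * (Real.exp (-t) / (1 + Real.exp (-t)) ^ 2)) t := by
  have h1 : 1 + Real.exp (-t) ≠ 0 := by positivity
  have h2 : HasDerivAt (fun t : ℝ => 1 + Real.exp (-t)) (Real.exp (-t) * -1) t :=
    ((hasDerivAt_neg t).exp).const_add 1
  have h3 := ((h2.inv h1).const_mul (1 - η)).const_add η
  have e : shiftedLogistic η = fun t => η + (1 - η) * (1 + Real.exp (-t))⁻¹ := by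
    ext t
    rw [shiftedLogistic, one_div]
  rw [e]
  refine h3.congr_deriv ?_
  ring

theorem abs_deriv_shiftedLogistic_le (hη0 : 0 < η) (hη1 : η < 1) (t : ℝ) :
    |(1 - η) * (Real.exp (-t) / (1 + Real.exp (-t)) ^ 2)| ≤ 1 := by
  have he := Real.exp_pos (-t)
  have h1 : Real.exp (-t) / (1 + Real.exp (-t)) ^ 2 ≤ 1 := by
    rw [div_le_one (by positivity)]
    nlinarith
  have h2 : 0 ≤ Real.exp (-t) / (1 + Real.exp (-t)) ^ 2 := by positivity
  rw [abs_of_nonneg (mul_nonneg (by linarith) h2)]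
  nlinarith

theorem contDiff_shiftedLogistic (η : ℝ) : ContDiff ℝ 1 (shiftedLogistic η) := by
  unfold shiftedLogistic
  exact contDiff_const.add (contDiff_const.mul (contDiff_const.div
    (contDiff_const.add contDiff_neg.exp) fun t => by positivity))

/-- The unnormalized density of the Gaussian mixture. -/
noncomputable def mixtureSum (η : ℝ) (z : Fin p → Eucl d) (θ : Eucl p) (x : Eucl d) : ℝ :=
  ∑ i, shiftedLogistic η (θ i) * Real.exp (-‖x - z i‖ ^ 2)

theorem le_mixtureSum (hη1 : η < 1) (θ : Eucl p) (x : Eucl d) :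
    η * ∑ i, Real.exp (-‖x - z i‖ ^ 2) ≤ mixtureSum η z θ x := by
  rw [Finset.mul_sum]
  exact Finset.sum_le_sum fun i _ =>
    mul_le_mul_of_nonneg_right (shiftedLogistic_mem hη1 _).1 (Real.exp_pos _).le

theorem mixtureSum_pos (hp : 0 < p) (hη0 : 0 < η) (hη1 : η < 1) (θ : Eucl p) (x : Eucl d) :
    0 < mixtureSum η z θ x := by
  have : Nonempty (Fin p) := ⟨⟨0, hp⟩⟩
  exact Finset.sum_pos (fun i _ => mul_pos (hη0.trans_le (shiftedLogistic_mem hη1 _).1)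
    (Real.exp_pos _)) Finset.univ_nonempty

theorem exp_neg_mixturePotential (hp : 0 < p) (hη0 : 0 < η) (hη1 : η < 1) (θ : Eucl p)
    (x : Eucl d) : Real.exp (-mixturePotential η z x θ) = mixtureSum η z θ x := by
  rw [mixturePotential, neg_neg]
  exact Real.exp_log (mixtureSum_pos hp hη0 hη1 θ x)

theorem contDiff_mixturePotential (hp : 0 < p) (hη0 : 0 < η) (hη1 : η < 1) :
    ContDiff ℝ 1 (fun a : Eucl d × Eucl p => mixturePotential η z a.1 a.2) := by
  have hs : ContDiff ℝ 1 (fun a : Eucl d × Eucl p => mixtureSum η z a.2 a.1) := by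
    unfold mixtureSum
    refine ContDiff.sum fun i _ => ContDiff.mul ?_ ?_
    · have h1 : ContDiff ℝ 1 (fun a : Eucl d × Eucl p => a.2 i) :=
        (EuclideanSpace.proj (𝕜 := ℝ) i : Eucl p →L[ℝ] ℝ).contDiff.comp contDiff_snd
      exact (contDiff_shiftedLogistic η).comp h1
    · have h2 : ContDiff ℝ 1 (fun a : Eucl d × Eucl p => a.1 - z i) :=
        contDiff_fst.sub contDiff_const
      exact (h2.norm_sq ℝ).neg.exp
  exact (hs.log fun a => (mixtureSum_pos hp hη0 hη1 a.2 a.1).ne').neg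

theorem gradient_mixturePotential_apply (hp : 0 < p) (hη0 : 0 < η) (hη1 : η < 1) (x : Eucl d)
    (θ : Eucl p) (i : Fin p) :
    gradient (mixturePotential η z x) θ i
      = -((1 - η) * (Real.exp (-θ i) / (1 + Real.exp (-θ i)) ^ 2)
        * Real.exp (-‖x - z i‖ ^ 2) / mixtureSum η z θ x) := by
  have hd (j : Fin p) : HasFDerivAt
      (fun θ : Eucl p => shiftedLogistic η (θ j) * Real.exp (-‖x - z j‖ ^ 2))
      (Real.exp (-‖x - z j‖ ^ 2) • ((1 - η) * (Real.exp (-θ j) / (1 + Real.exp (-θ j)) ^ 2)) •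
        (EuclideanSpace.proj j : Eucl p →L[ℝ] ℝ)) θ :=
    ((hasDerivAt_shiftedLogistic η (θ j)).comp_hasFDerivAt θ
      (EuclideanSpace.proj j : Eucl p →L[ℝ] ℝ).hasFDerivAt).mul_const _
  have h := ((HasFDerivAt.fun_sum fun j (_ : j ∈ Finset.univ) => hd j).log
    (mixtureSum_pos hp hη0 hη1 θ x).ne').neg
  have e : gradient (mixturePotential η z x) θ i
      = fderiv ℝ (mixturePotential η z x) θ (EuclideanSpace.single i 1) := by
    rw [← inner_gradient_left, EuclideanSpace.inner_single_right]
    simp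
  rw [e]
  have h2 : fderiv ℝ (mixturePotential η z x) θ = _ := h.fderiv
  rw [show ∑ j, shiftedLogistic η (θ j) * Real.exp (-‖x - z j‖ ^ 2) = mixtureSum η z θ x from rfl]
    at h2
  rw [h2, neg_apply, smul_apply, sum_apply, Finset.sum_eq_single i]
  · simp
    ring
  · intro j _ hj
    simp [hj]
  · simp

theorem sum_abs_gradient_mixturePotential_le (hp : 0 < p) (hη0 : 0 < η) (hη1 : η < 1) (x : Eucl d)
    (θ : Eucl p) : ∑ i, |gradient (mixturePotential η z x) θ i| ≤ 1 / η := by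
  have hS := mixtureSum_pos (z := z) hp hη0 hη1 θ x
  calc ∑ i, |gradient (mixturePotential η z x) θ i|
      ≤ ∑ i, Real.exp (-‖x - z i‖ ^ 2) / mixtureSum η z θ x := by
        refine Finset.sum_le_sum fun i _ => ?_
        rw [gradient_mixturePotential_apply hp hη0 hη1, abs_neg, abs_div, abs_mul, abs_of_pos hS,
          Real.abs_exp]
        gcongr
        exact mul_le_of_le_one_left (Real.exp_pos _).le
          (abs_deriv_shiftedLogistic_le hη0 hη1 (θ i))
    _ ≤ 1 / η := by
        rw [← Finset.sum_div, div_le_div_iff₀ hS hη0, one_mul, mul_comm]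
        exact le_mixtureSum hη1 θ x

theorem norm_le_sum_abs (v : Eucl p) : ‖v‖ ≤ ∑ i, |v i| := by
  rw [EuclideanSpace.norm_eq]
  refine Real.sqrt_le_iff.2 ⟨Finset.sum_nonneg fun i _ => abs_nonneg _, ?_⟩
  exact Finset.sum_sq_le_sq_sum_of_nonneg fun i _ => abs_nonneg _

/-- In the expansion of `‖(x - w) + t‖²`, the inner product accounts for `2 (|r| + R)`, and `‖t‖² ≤
‖t‖` for the additional 1. -/
theorem exp_neg_sq_norm_add_le {x t w : Eucl d} {r R : ℝ} (hx : ‖x‖ ≤ r) (hw : ‖w‖ ≤ R)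
    (ht : ‖t‖ ≤ 1) :
    Real.exp (-‖x + t - w‖ ^ 2)
      ≤ Real.exp ((2 * (|r| + R) + 1) * ‖t‖) * Real.exp (-‖x - w‖ ^ 2) ∧
    Real.exp (-‖x - w‖ ^ 2)
      ≤ Real.exp ((2 * (|r| + R) + 1) * ‖t‖) * Real.exp (-‖x + t - w‖ ^ 2) := by
  have e : x + t - w = (x - w) + t := by abel
  have h1 : ‖x - w‖ ≤ |r| + R := (norm_sub_le _ _).trans (add_le_add (hx.trans (le_abs_self r)) hw)
  have h2 := norm_add_sq_real (x - w) t
  have h3 := abs_le.1 (abs_real_inner_le_norm (x - w) t)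
  have h4 : ‖x - w‖ * ‖t‖ ≤ (|r| + R) * ‖t‖ := mul_le_mul_of_nonneg_right h1 (norm_nonneg t)
  have h5 : ‖t‖ ^ 2 ≤ ‖t‖ := by nlinarith [norm_nonneg t]
  have h6 := norm_nonneg t
  have h7 := sq_nonneg ‖t‖
  rw [e, ← Real.exp_add, ← Real.exp_add]
  constructor <;> refine Real.exp_le_exp.2 ?_ <;> nlinarith [h3.1, h3.2]

theorem continuous_mixtureSum (η : ℝ) (z : Fin p → Eucl d) (θ : Eucl p) :
    Continuous (mixtureSum η z θ) := by
  unfold mixtureSum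
  fun_prop

theorem integrable_mixtureSum (η : ℝ) (z : Fin p → Eucl d) (θ : Eucl p) :
    Integrable (mixtureSum η z θ) :=
  integrable_finsetSum _ fun i _ => (integrable_exp_neg_sq_norm_sub (z i)).const_mul _

theorem isRegularDensity_mixtureSum (hp : 0 < p) (hη0 : 0 < η) (hη1 : η < 1) (θ : Eucl p) {Z : ℝ}
    (hZ : 0 < Z) : IsRegularDensity fun x => mixtureSum η z θ x / Z where
  continuous := (continuous_mixtureSum η z θ).div_const Z
  pos x := div_pos (mixtureSum_pos hp hη0 hη1 θ x) hZ
  bounded := by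
    refine ⟨(∑ _i : Fin p, 1) / Z, fun x => ?_⟩
    refine div_le_div_of_nonneg_right (Finset.sum_le_sum fun i _ => ?_) hZ.le
    have h1 := shiftedLogistic_mem hη1 (θ i)
    have h2 : Real.exp (-‖x - z i‖ ^ 2) ≤ 1 := Real.exp_le_one_iff.2 (by simp)
    exact mul_le_one₀ h1.2 (Real.exp_pos _).le h2
  log_lipschitz r := by
    have hzR (i : Fin p) : ‖z i‖ ≤ ∑ j, ‖z j‖ :=
      Finset.single_le_sum (f := fun j => ‖z j‖) (fun j _ => norm_nonneg _) (Finset.mem_univ i)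
    have hR : 0 ≤ ∑ j, ‖z j‖ := Finset.sum_nonneg fun j _ => norm_nonneg _
    refine ⟨2 * (|r| + ∑ j, ‖z j‖) + 1, by positivity, fun x t hx ht => ?_⟩
    have hH (i : Fin p) : 0 ≤ shiftedLogistic η (θ i) :=
      hη0.le.trans (shiftedLogistic_mem hη1 _).1
    constructor
    · rw [← mul_div_assoc]
      refine div_le_div_of_nonneg_right ?_ hZ.le
      rw [mixtureSum, mixtureSum, Finset.mul_sum]
      refine Finset.sum_le_sum fun i _ => ?_
      rw [mul_left_comm]
      exact mul_le_mul_of_nonneg_left (exp_neg_sq_norm_add_le hx (hzR i) ht).1 (hH i)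
    · rw [← mul_div_assoc]
      refine div_le_div_of_nonneg_right ?_ hZ.le
      rw [mixtureSum, mixtureSum, Finset.mul_sum]
      refine Finset.sum_le_sum fun i _ => ?_
      rw [mul_left_comm]
      exact mul_le_mul_of_nonneg_left (exp_neg_sq_norm_add_le hx (hzR i) ht).2 (hH i)

theorem gibbs_mixturePotential_eq (hp : 0 < p) (hη0 : 0 < η) (hη1 : η < 1) (θ : Eucl p) :
    gibbs (mixturePotential η z) θ = volume.withDensity fun x =>
      ENNReal.ofReal (mixtureSum η z θ x / ∫ y, mixtureSum η z θ y) := by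
  rw [gibbs, Measure.tilted]
  simp_rw [exp_neg_mixturePotential hp hη0 hη1]

theorem isProbabilityMeasure_gibbs_mixturePotential (hp : 0 < p) (hη0 : 0 < η) (hη1 : η < 1)
    (θ : Eucl p) : IsProbabilityMeasure (gibbs (mixturePotential η z) θ) := by
  refine isProbabilityMeasure_tilted ?_
  simp_rw [exp_neg_mixturePotential hp hη0 hη1]
  exact integrable_mixtureSum η z θ

theorem integral_mixtureSum (η : ℝ) (z : Fin p → Eucl d) (θ : Eucl p) :
    ∫ x, mixtureSum η z θ x
      = (∑ i, shiftedLogistic η (θ i)) * ∫ x : Eucl d, Real.exp (-‖x‖ ^ 2) := by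
  unfold mixtureSum
  rw [integral_finsetSum _ fun i _ => (integrable_exp_neg_sq_norm_sub (z i)).const_mul _,
    Finset.sum_mul]
  refine Finset.sum_congr rfl fun i _ => ?_
  rw [integral_const_mul, integral_sub_right_eq_self (fun x : Eucl d => Real.exp (-‖x‖ ^ 2))]

/-- By translation invariance all summands have the same Gaussian mass, so the normalization reduces
to dividing by the sum of the coefficients. -/
theorem isGaussianMixture_gibbs (hp : 0 < p) (hη0 : 0 < η) (hη1 : η < 1) (θ : Eucl p) :
    IsGaussianMixture (gibbs (mixturePotential η z) θ)
      (fun i => shiftedLogistic η (θ i) / ∑ j, shiftedLogistic η (θ j)) z where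
  sum_eq_one := by
    have : Nonempty (Fin p) := ⟨⟨0, hp⟩⟩
    rw [← Finset.sum_div, div_self]
    exact (Finset.sum_pos (fun i _ => hη0.trans_le (shiftedLogistic_mem hη1 _).1)
      Finset.univ_nonempty).ne'
  integral_eq f a b hf ha hb := by
    have hi (i : Fin p) : Integrable fun x => Real.exp (-‖x - z i‖ ^ 2) * f x := by
      refine (integrable_exp_neg_sq_norm_sub (z i)).mul_bdd (c := |a| + |b|)
        hf.aestronglyMeasurable (ae_of_all _ fun x => ?_)
      rw [Real.norm_eq_abs, abs_le]
      constructor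
      · linarith [ha x, neg_abs_le a, abs_nonneg b]
      · linarith [hb x, le_abs_self b, abs_nonneg a]
    rw [gibbs, integral_tilted]
    simp_rw [exp_neg_mixturePotential hp hη0 hη1, integral_add_halfGaussian]
    have e (x : Eucl d) : (mixtureSum η z θ x / ∫ y, mixtureSum η z θ y) • f x
        = ∑ i, shiftedLogistic η (θ i) / (∫ y, mixtureSum η z θ y) *
          (Real.exp (-‖x - z i‖ ^ 2) * f x) := by
      rw [smul_eq_mul, mixtureSum, Finset.sum_div, Finset.sum_mul]
      exact Finset.sum_congr rfl fun i _ => by ring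
    simp_rw [e]
    rw [integral_finsetSum _ fun i _ => (hi i).const_mul _]
    refine Finset.sum_congr rfl fun i _ => ?_
    rw [integral_const_mul, integral_mixtureSum, div_mul_eq_div_div, ← mul_assoc, div_eq_mul_inv _
      (∫ x : Eucl d, Real.exp (-‖x‖ ^ 2))]

theorem smoothLSI_of_isGaussianMixture {Q : Measure (Eucl d)} {w : Fin p → ℝ}
    (hQ : IsGaussianMixture Q w z) {κ R : ℝ} (hκ : 0 < κ) (hw : ∀ i, κ ≤ w i)
    (hR : ∀ i j, ‖z i - z j‖ ≤ R) :
    SmoothLSI Q (2 * (∫ x, ‖x‖ ^ 2 ∂(halfGaussian (Eucl d)))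
      + 8 * R ^ 2 * Real.exp (R ^ 2 / 4) * κ⁻¹) := by
  intro u hu hc h0 ε hε
  obtain ⟨M, L, K, h⟩ := slopeBound_of_contDiff hu hc h0 ε
  exact hQ.lsi hκ hw hR hε h

theorem SmoothLSI.mono {Q : Measure (Eucl d)} {C C' : ℝ} (h : SmoothLSI Q C) (hC : C ≤ C') :
    SmoothLSI Q C' := fun u hu hc h0 ε hε =>
  (h u hu hc h0 ε hε).trans (mul_le_mul_of_nonneg_right hC (integral_nonneg fun x =>
    div_nonneg (sq_nonneg _) (by linarith [h0 x])))

theorem uniformLogSobolev_mixturePotential (hp : 0 < p) (z : Fin p → Eucl d) (hη0 : 0 < η)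
    (hη1 : η < 1) : UniformLogSobolev (mixturePotential η z) := by
  have : Nonempty (Fin p) := ⟨⟨0, hp⟩⟩
  have hp' : (0 : ℝ) < p := by exact_mod_cast hp
  set R := 2 * ∑ j, ‖z j‖ with hRdef
  have hzR (i : Fin p) : ‖z i‖ ≤ ∑ j, ‖z j‖ :=
    Finset.single_le_sum (f := fun j => ‖z j‖) (fun j _ => norm_nonneg _) (Finset.mem_univ i)
  have hR (i j : Fin p) : ‖z i - z j‖ ≤ R :=
    (norm_sub_le _ _).trans (by rw [hRdef]; linarith [hzR i, hzR j])
  have hκ : 0 < η / p := by positivity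
  set C₀ := 2 * (∫ x, ‖x‖ ^ 2 ∂(halfGaussian (Eucl d)))
      + 8 * R ^ 2 * Real.exp (R ^ 2 / 4) * (η / p)⁻¹
  have hC₀ : 0 ≤ C₀ := by
    have : 0 ≤ ∫ x, ‖x‖ ^ 2 ∂(halfGaussian (Eucl d)) := integral_nonneg fun x => by positivity
    positivity
  -- `C₀` vanishes when `d = 0`; adding 1 makes the constant strictly positive.
  have hC : 0 < C₀ + 1 := by linarith
  refine ⟨1 / (4 * (C₀ + 1)), by positivity, fun θ => ?_⟩
  have hprob := isProbabilityMeasure_gibbs_mixturePotential (z := z) hp hη0 hη1 θ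
  refine ⟨hprob, ?_⟩
  -- The source of uniformity in `θ`: each coefficient lies in `[η, 1]`, so each normalized weight
  -- is at least `η / p`.
  have hw (i : Fin p) :
      η / p ≤ shiftedLogistic η (θ i) / ∑ j, shiftedLogistic η (θ j) := by
    have hH (j : Fin p) := shiftedLogistic_mem hη1 (θ j)
    have hsum : ∑ j, shiftedLogistic η (θ j) ≤ p := by
      simpa using Finset.sum_le_sum fun j (_ : j ∈ Finset.univ) => (hH j).2
    have hpos : 0 < ∑ j, shiftedLogistic η (θ j) :=
      Finset.sum_pos (fun j _ => hη0.trans_le (hH j).1) Finset.univ_nonempty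
    exact div_le_div₀ (hη0.le.trans (hH i).1) (hH i).1 hpos hsum
  have hZ : 0 < ∫ y, mixtureSum η z θ y := by
    have := integral_exp_pos (μ := (volume : Measure (Eucl d)))
      (f := fun x => -mixturePotential η z x θ)
      (by simpa only [exp_neg_mixturePotential hp hη0 hη1] using integrable_mixtureSum η z θ)
    simpa only [exp_neg_mixturePotential hp hη0 hη1] using this
  exact ((smoothLSI_of_isGaussianMixture (isGaussianMixture_gibbs hp hη0 hη1 θ) hκ hw hR).mono
    (by linarith)).logSobolev hC (isRegularDensity_mixtureSum hp hη0 hη1 θ hZ)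
    (gibbs_mixturePotential_eq hp hη0 hη1 θ)

end Potential

theorem mainTheorem5 (d p : ℕ) (hp : 0 < p) (z : Fin p → Eucl d) (η : ℝ)
    (hη0 : 0 < η) (hη1 : η < 1) :
    UniformLogSobolev (mixturePotential η z) ∧
    (∃ C : ℝ, BoundedParamGradient (mixturePotential η z) C) ∧
    ∀ (x : Eucl d) (θ : Eucl p),
      ∑ i, |gradient (mixturePotential η z x) θ i| ≤ 1 / η :=
  ⟨uniformLogSobolev_mixturePotential hp z hη0 hη1,
    ⟨1 / η, contDiff_mixturePotential hp hη0 hη1, fun θ x => (norm_le_sum_abs _).trans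
      (sum_abs_gradient_mixturePotential_le hp hη0 hη1 x θ)⟩,
    sum_abs_gradient_mixturePotential_le hp hη0 hη1⟩
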